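/- Let $\mathbb{F}$ be a division ring, $\sigma:\mathbb{F}\to\mathbb{F}$ a ring endomorphism and $\delta:\mathbb{F}\to\mathbb{F}$ a $\sigma$-derivation, i.e. $\delta$ is additive and $\delta(ab)=\sigma(a)\delta(b)+\delta(a)b$. Let $\mathcal{R}=\mathbb{F}[x;\sigma,\delta]$ be the skew polynomial ring: the left $\mathbb{F}$-vector space with basis $1,x,x^2,\dots$ and the product determined by $xa=\sigma(a)x+\delta(a)$ for $a \in \mathbb{F}$. For $F,P\in\mathcal{R}$ with $\deg P\ge 1$, let $F(P)$ be the remainder of $F$ in the division $F=GP+F(P)$, $\deg F(P)<\deg P$; an element $c\in\mathbb{F}$ is a zero of $F$ if $F(x-c)=0$. For $r\ge 1$ and $\mathbf{a}=(a_1,\dots,a_r)\in\mathbb{F}^r$ put $P_{\mathbf a}=(x-a_r)\cdots(x-a_2)(x-a_1)$, and call $\mathbf a$ a multiplicity sequence (starting at $a_1$) if $a_1$ is the only zero of $P_{\mathbf a}$. Let $\mathcal{U}_0=\{x-c: c\in\mathbb{F}\}$ and $\mathcal{U}_2=\{P_{\mathbf a}:\mathbf a \text{ a multiplicity sequence of some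 length } r\ge 1\}$; subsets of $\mathbb{F}$ are identified with subsets of $\mathcal{U}_0$. Let $\mathcal{U}$ be $\mathcal{U}_0$ or $\mathcal{U}_2$ and $\Omega\subseteq\mathcal{U}$. Put $I(\Omega)=\{F\in\mathcal{R}: F(P)=0\text{ for all }P\in\Omega\}$. Call $\Omega$ algebraic if $I(\Omega)\ne\{0\}$. Let $F_\Omega$ be the monic element of least degree among the non-zero elements of $I(\Omega)$ if $\Omega$ is algebraic, and $F_\Omega=0$ otherwise; for finite algebraic $\Omega$ it is the least left common multiple of the elements of $\Omega$. Let $\mathrm{Rk}(\Omega)=\deg F_\Omega$. The P-closure of $\Omega$ in $\mathcal{U}$ is $\overline\Omega=\{P\in\mathcal{U}:F(P)=0\text{ for all }F\in I(\Omega)\}$, and $\Omega$ is P-closed if $\overline\Omega=\Omega$. Call $\Omega$ P-independent if it is finite, algebraic and $\deg F_\Omega=\sum_{P\in\Omega}\deg P$. Write $\mathcal B\le\Omega$ if, for any $n\geq 1$ distinct elements $Q_1,\dots,Q_n$ of $\mathcal B$, there are $n$ distinct elements $P_1,\dots,P_n$ of $\Omega$ such that $Q_i$ divides $P_i$ on the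 right for all $i$. A P-basis of a P-closed set $\Omega\subseteq \mathcal{U}$ is a P-independent set $\mathcal B\subseteq\mathcal{U}$ with $\mathcal B\le\Omega$ and $\overline{\mathcal B}=\Omega$. The conjugacy class of $a\in\mathbb{F}$ is $C(a)=\{\sigma(\beta)a\beta^{-1}+\delta(\beta)\beta^{-1}:\beta\in\mathbb{F}\setminus\{0\}\}$. **Theorem.** Assume that the conjugacy class of every element of $\mathbb{F}$ is algebraic. Let $a\in\mathbb{F}$ and $r\ge 1$. 1. If $\mathbf b=(b_1,\dots,b_r)$ is a multiplicity sequence with $b_1\in C(a)$, then $P_{\mathbf b}$ divides $F_{C(a)}^r$ on the right. 2. Let $a_1,\dots,a_m$ be distinct elements of $\mathbb{F}$ forming a P-basis of $C(a)$ (in $\mathcal{U}_0$), let $\mathbf a_i\in\mathbb{F}^r$ be a multiplicity sequence starting at $a_i$, for $i=1,\dots,m$, and put $\Omega=\{P_{\mathbf a_1},\dots,P_{\mathbf a_m}\}$. Then $F_\Omega=F_{C(a)}^r$. 3. The set $C_r(a)=\{P_{\mathbf b}:\mathbf b\in\mathbb{F}^i\text{ a multiplicity sequence},\ b_1\in C(a),\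 1\le i\le r\}\subseteq\mathcal{U}_2$ is P-closed in $\mathcal{U}_2$, has minimal skew polynomial $F_{C_r(a)}=F_{C(a)}^r$, has every $\Omega$ as in item 2 as a P-basis, and satisfies $\mathrm{Rk}(C_r(a))=r\cdot\mathrm{Rk}(C(a))$. -/

import Mathlib

/-- A `σ`-derivation of a ring `F`, for a ring endomorphism `σ` of `F`: an additive map `δ`
with `δ (a * b) = σ a * δ b + δ a * b`. -/
structure SkewDerivation {F : Type*} [Ring F] (σ : F →+* F) extends F →+ F where
  leibniz : ∀ a b : F, toFun (a * b) = σ a * toFun b + toFun a * b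

/-- The left vector space underlying `F[x; σ, δ]`: finitely supported sequences of coefficients,
`f` standing for `∑ f i x ^ i` with the coefficients on the left. -/
def SkewPoly {F : Type*} [DivisionRing F] {σ : F →+* F} (_δ : SkewDerivation σ) : Type _ :=
  ℕ →₀ F

namespace SkewPoly

noncomputable section

variable {F : Type*} [DivisionRing F] {σ : F →+* F} {δ : SkewDerivation σ}

instance : AddCommGroup (SkewPoly δ) := inferInstanceAs (AddCommGroup (ℕ →₀ F))

instance : Module F (SkewPoly δ) := inferInstanceAs (Module F (ℕ →₀ F))

/-- The sequence of coefficients. -/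
def coeffs (f : SkewPoly δ) : ℕ →₀ F := f

/-- The coefficient of `x ^ n`. -/
def coeff (f : SkewPoly δ) (n : ℕ) : F := coeffs f n

/-- The skew polynomial `c x ^ n`. -/
def monomial (δ : SkewDerivation σ) (n : ℕ) (c : F) : SkewPoly δ :=
  (Finsupp.single n c : ℕ →₀ F)

/-- The degree, with `degree 0 = ⊥`. -/
def degree (f : SkewPoly δ) : WithBot ℕ := (coeffs f).support.max

@[ext] theorem ext {f g : SkewPoly δ} (h : ∀ n, coeff f n = coeff g n) : f = g :=
  Finsupp.ext h

@[simp] theorem coeff_zero (n : ℕ) : coeff (0 : SkewPoly δ) n = 0 := rfl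

@[simp] theorem coeff_add (f g : SkewPoly δ) (n : ℕ) :
    coeff (f + g) n = coeff f n + coeff g n := rfl

@[simp] theorem coeff_sub (f g : SkewPoly δ) (n : ℕ) :
    coeff (f - g) n = coeff f n - coeff g n := rfl

@[simp] theorem coeff_smul (c : F) (f : SkewPoly δ) (n : ℕ) :
    coeff (c • f) n = c * coeff f n := rfl

theorem coeff_monomial (n k : ℕ) (c : F) :
    coeff (monomial δ n c) k = if n = k then c else 0 := by
  classical
  exact Finsupp.single_apply

theorem induction_on {p : SkewPoly δ → Prop} (f : SkewPoly δ) (h0 : p 0)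
    (hadd : ∀ f g, p f → p g → p (f + g)) (hmon : ∀ n c, p (monomial δ n c)) : p f :=
  Finsupp.induction_linear f h0 hadd hmon

/-- Left multiplication by `x`: the additive map with `c x ^ i ↦ σ c x ^ (i + 1) + δ c x ^ i`. -/
def xMul (δ : SkewDerivation σ) : SkewPoly δ →+ SkewPoly δ :=
  (Finsupp.liftAddHom fun i : ℕ =>
    (Finsupp.singleAddHom (i + 1)).comp (σ : F →+ F) +
      (Finsupp.singleAddHom i).comp δ.toAddMonoidHom : (ℕ →₀ F) →+ (ℕ →₀ F))

theorem xMul_monomial (n : ℕ) (c : F) :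
    xMul δ (monomial δ n c) = monomial δ (n + 1) (σ c) + monomial δ n (δ.toFun c) := by
  refine (Finsupp.liftAddHom_apply_single _ n c).trans ?_
  rfl

theorem xMul_smul (c : F) (f : SkewPoly δ) :
    xMul δ (c • f) = σ c • xMul δ f + δ.toFun c • f := by
  induction f using induction_on with
  | h0 => simp
  | hadd f g hf hg => rw [smul_add, map_add, hf, hg, map_add, smul_add, smul_add]; abel
  | hmon n d =>
    have h : ∀ (e : F) (k : ℕ), e • monomial δ k d = monomial δ k (e * d) := fun e k => by
      ext j; simp [coeff_monomial]
    rw [h, xMul_monomial, xMul_monomial]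
    ext j
    simp only [coeff_add, coeff_smul, coeff_monomial, map_mul, δ.leibniz]
    split_ifs <;> simp [mul_add, add_assoc]

/-- The product of `F[x; σ, δ]`: `(∑ f i x ^ i) * g = ∑ f i (x ^ i * g)`. -/
instance : Mul (SkewPoly δ) :=
  ⟨fun f g => Finsupp.sum (coeffs f) fun i c => c • (xMul δ)^[i] g⟩

instance : One (SkewPoly δ) := ⟨monomial δ 0 1⟩

theorem monomial_mul (n : ℕ) (c : F) (g : SkewPoly δ) :
    monomial δ n c * g = c • (xMul δ)^[n] g :=
  Finsupp.sum_single_index (zero_smul F _)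

theorem add_mul' (f g h : SkewPoly δ) : (f + g) * h = f * h + g * h :=
  Finsupp.sum_add_index' (fun _ => zero_smul F _) (fun _ _ _ => add_smul _ _ _)

theorem zero_mul' (g : SkewPoly δ) : 0 * g = 0 := Finsupp.sum_zero_index

theorem mul_add' (f g h : SkewPoly δ) : f * (g + h) = f * g + f * h := by
  induction f using induction_on with
  | h0 => simp [zero_mul']
  | hadd f₁ f₂ h₁ h₂ => rw [add_mul', add_mul', add_mul', h₁, h₂]; abel
  | hmon n c => rw [monomial_mul, monomial_mul, monomial_mul, iterate_map_add, smul_add]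

theorem smul_mul' (c : F) (f g : SkewPoly δ) : (c • f) * g = c • (f * g) := by
  induction f using induction_on with
  | h0 => simp [zero_mul']
  | hadd f₁ f₂ h₁ h₂ => rw [smul_add, add_mul', add_mul', h₁, h₂, smul_add]
  | hmon n d =>
    have h : c • monomial δ n d = monomial δ n (c * d) := by
      ext j; simp [coeff_monomial]
    rw [h, monomial_mul, monomial_mul, mul_smul]

theorem xMul_mul (f g : SkewPoly δ) : xMul δ (f * g) = xMul δ f * g := by
  induction f using induction_on with
  | h0 => simp [zero_mul']
  | hadd f₁ f₂ h₁ h₂ => rw [add_mul', map_add, map_add, add_mul', h₁, h₂]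
  | hmon n c =>
    rw [monomial_mul, xMul_monomial, add_mul', monomial_mul, monomial_mul, xMul_smul,
      Function.iterate_succ_apply']

theorem xMul_iterate_mul (n : ℕ) (f g : SkewPoly δ) :
    (xMul δ)^[n] (f * g) = (xMul δ)^[n] f * g := by
  induction n with
  | zero => rfl
  | succ n ih => rw [Function.iterate_succ_apply', Function.iterate_succ_apply', ih, xMul_mul]

theorem mul_assoc' (f g h : SkewPoly δ) : f * g * h = f * (g * h) := by
  induction f using induction_on with
  | h0 => simp [zero_mul']
  | hadd f₁ f₂ h₁ h₂ => rw [add_mul', add_mul', add_mul', h₁, h₂]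
  | hmon n c => rw [monomial_mul, monomial_mul, smul_mul', xMul_iterate_mul]

theorem one_mul' (f : SkewPoly δ) : 1 * f = f :=
  (monomial_mul 0 1 f).trans (one_smul F f)

theorem derivation_one (δ : SkewDerivation σ) : δ.toFun 1 = 0 := by
  simpa using δ.leibniz 1 1

theorem xMul_iterate_one (n : ℕ) : (xMul δ)^[n] 1 = monomial δ n 1 := by
  induction n with
  | zero => rfl
  | succ n ih =>
    rw [Function.iterate_succ_apply', ih, xMul_monomial, derivation_one, map_one]
    ext j; simp [coeff_monomial]

theorem mul_one' (f : SkewPoly δ) : f * 1 = f := by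
  induction f using induction_on with
  | h0 => simp [zero_mul']
  | hadd f₁ f₂ h₁ h₂ => rw [add_mul', h₁, h₂]
  | hmon n c =>
    rw [monomial_mul, xMul_iterate_one]
    ext j; simp [coeff_monomial]

/-- The skew polynomial ring `F[x; σ, δ]`. -/
instance : Ring (SkewPoly δ) :=
  { (inferInstance : AddCommGroup (SkewPoly δ)) with
    mul := (· * ·)
    one := 1
    left_distrib := mul_add'
    right_distrib := add_mul'
    zero_mul := zero_mul'
    mul_zero := fun f => by
      have h := mul_add' f 0 0
      rw [add_zero] at h
      exact left_eq_add.mp h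
    mul_assoc := mul_assoc'
    one_mul := one_mul'
    mul_one := mul_one' }

/-- The constant skew polynomial `c`. -/
def const (δ : SkewDerivation σ) (c : F) : SkewPoly δ := monomial δ 0 c

/-- The variable `x`. -/
def X (δ : SkewDerivation σ) : SkewPoly δ := monomial δ 1 1

/-- The defining commutation rule of `F[x; σ, δ]`. -/
theorem X_mul_const (c : F) :
    X δ * const δ c = const δ (σ c) * X δ + const δ (δ.toFun c) := by
  simp only [X, const, monomial_mul, Function.iterate_one, Function.iterate_zero, id_eq,
    xMul_monomial, one_smul]
  ext j; simp [coeff_monomial]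

theorem X_pow (n : ℕ) : X δ ^ n = monomial δ n 1 := by
  induction n with
  | zero => rfl
  | succ n ih =>
    rw [pow_succ', ih, X, monomial_mul, one_smul, Function.iterate_one, xMul_monomial,
      derivation_one, map_one]
    ext j; simp [coeff_monomial]

theorem monomial_eq (n : ℕ) (c : F) : monomial δ n c = const δ c * X δ ^ n := by
  rw [X_pow, const, monomial_mul]
  ext j; simp [coeff_monomial]

theorem smul_eq (c : F) (f : SkewPoly δ) : c • f = const δ c * f := by
  rw [const, monomial_mul]; rfl

/-! ### Degrees and right Euclidean division -/

theorem degree_lt_iff (f : SkewPoly δ) (n : ℕ) :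
    degree f < n ↔ ∀ k, n ≤ k → coeff f k = 0 := by
  classical
  rw [degree, Finset.max_eq_sup_withBot]
  refine (Finset.sup_lt_iff (WithBot.bot_lt_coe n)).trans ?_
  constructor
  · intro h k hk
    by_contra hne
    have := h k (Finsupp.mem_support_iff.mpr hne)
    exact absurd (WithBot.coe_lt_coe.mp this) (not_lt.mpr hk)
  · intro h k hk
    refine WithBot.coe_lt_coe.mpr (lt_of_not_ge fun hle => ?_)
    exact (Finsupp.mem_support_iff.mp hk) (h k hle)

theorem coeff_ne_zero_of_degree_eq {f : SkewPoly δ} {n : ℕ} (h : degree f = n) :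
    coeff f n ≠ 0 :=
  Finsupp.mem_support_iff.mp (Finset.mem_of_max h)

theorem degree_eq_iff (f : SkewPoly δ) (n : ℕ) :
    degree f = n ↔ coeff f n ≠ 0 ∧ ∀ k, n < k → coeff f k = 0 := by
  constructor
  · intro h
    refine ⟨coeff_ne_zero_of_degree_eq h, (degree_lt_iff f (n + 1)).mp ?_⟩
    rw [h]; exact_mod_cast Nat.lt_succ_self n
  · rintro ⟨h₁, h₂⟩
    refine le_antisymm ?_ (Finset.le_max (Finsupp.mem_support_iff.mpr h₁))
    have : degree f < ((n + 1 : ℕ) : WithBot ℕ) := (degree_lt_iff f (n + 1)).mpr h₂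
    exact Order.le_of_lt_succ this

theorem degree_eq_bot_iff (f : SkewPoly δ) : degree f = ⊥ ↔ f = 0 :=
  Finset.max_eq_bot.trans Finsupp.support_eq_empty

theorem exists_degree_eq {f : SkewPoly δ} (hf : f ≠ 0) : ∃ n : ℕ, degree f = n := by
  obtain ⟨n, hn⟩ := WithBot.ne_bot_iff_exists.mp (mt (degree_eq_bot_iff f).mp hf)
  exact ⟨n, hn.symm⟩

theorem coeff_xMul_succ (f : SkewPoly δ) (n : ℕ) :
    coeff (xMul δ f) (n + 1) = σ (coeff f n) + δ.toFun (coeff f (n + 1)) := by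
  have h0 : δ.toFun 0 = 0 := δ.map_zero'
  induction f using induction_on with
  | h0 => simp [h0]
  | hadd f g hf hg =>
    have := δ.map_add' (coeff f (n + 1)) (coeff g (n + 1))
    simp only [map_add, coeff_add, hf, hg]
    rw [show δ.toFun (coeff f (n + 1) + coeff g (n + 1)) = _ from this]
    simp only [ZeroHom.toFun_eq_coe]
    abel
  | hmon k c =>
    rw [xMul_monomial]
    simp only [coeff_add, coeff_monomial, Nat.add_right_cancel_iff]
    split_ifs <;> simp_all

theorem degree_xMul_iterate {f : SkewPoly δ} {n : ℕ} (h : degree f = n) (k : ℕ) :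
    degree ((xMul δ)^[k] f) = ((k + n : ℕ) : WithBot ℕ) := by
  have h0 : δ.toFun 0 = 0 := δ.map_zero'
  induction k with
  | zero => simpa using h
  | succ k ih =>
    rw [degree_eq_iff] at ih ⊢
    rw [Function.iterate_succ_apply', show k + 1 + n = k + n + 1 by omega]
    refine ⟨?_, ?_⟩
    · rw [coeff_xMul_succ, ih.2 _ (Nat.lt_succ_self _), h0, add_zero]
      exact (map_ne_zero σ).mpr ih.1
    · intro j hj
      obtain ⟨i, rfl⟩ : ∃ i, j = i + 1 := ⟨j - 1, by omega⟩
      rw [coeff_xMul_succ, ih.2 i (by omega), ih.2 (i + 1) (by omega), h0, map_zero, add_zero]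

theorem degree_mul {f g : SkewPoly δ} {m n : ℕ} (hf : degree f = m) (hg : degree g = n) :
    degree (f * g) = ((m + n : ℕ) : WithBot ℕ) := by
  have key : ∀ k, coeff (f * g) k =
      ∑ i ∈ (coeffs f).support, coeff f i * coeff ((xMul δ)^[i] g) k := by
    intro k
    exact Finsupp.finsetSum_apply _ _ _
  have hmax : ∀ i ∈ (coeffs f).support, i ≤ m := fun i hi => by
    have := Finset.le_max hi
    rw [show (coeffs f).support.max = (m : WithBot ℕ) from hf] at this
    exact WithBot.coe_le_coe.mp this
  rw [degree_eq_iff]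
  constructor
  · rw [key, Finset.sum_eq_single m]
    · exact mul_ne_zero (coeff_ne_zero_of_degree_eq hf)
        ((degree_eq_iff _ _).mp (degree_xMul_iterate hg m)).1
    · intro i hi him
      have := hmax i hi
      rw [((degree_eq_iff _ _).mp (degree_xMul_iterate hg i)).2 _ (by omega), mul_zero]
    · intro hm
      exact absurd (Finset.mem_of_max hf) hm
  · intro k hk
    rw [key]
    refine Finset.sum_eq_zero fun i hi => ?_
    have := hmax i hi
    rw [((degree_eq_iff _ _).mp (degree_xMul_iterate hg i)).2 _ (by omega), mul_zero]

/-- Right Euclidean division. -/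
theorem exists_remainder (f : SkewPoly δ) {p : SkewPoly δ} (hp : p ≠ 0) :
    ∃ q s : SkewPoly δ, f = q * p + s ∧ degree s < degree p := by
  obtain ⟨n, hn⟩ := exists_degree_eq hp
  have main : ∀ (N : ℕ) (f : SkewPoly δ), degree f < N →
      ∃ q s : SkewPoly δ, f = q * p + s ∧ degree s < degree p := by
    intro N
    induction N with
    | zero =>
      intro f hf
      refine ⟨0, f, by rw [zero_mul, zero_add], hf.trans_le ?_⟩
      rw [hn]; exact_mod_cast Nat.zero_le n
    | succ N ih =>
      intro f hf
      rcases lt_or_ge N n with hNn | hNn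
      · refine ⟨0, f, by rw [zero_mul, zero_add], hf.trans_le ?_⟩
        rw [hn]; exact_mod_cast hNn
      · have hdeg := degree_xMul_iterate hn (N - n)
        rw [Nat.sub_add_cancel hNn, degree_eq_iff] at hdeg
        set t := (xMul δ)^[N - n] p with ht
        set c := coeff f N * (coeff t N)⁻¹ with hc
        have hct : c • t = monomial δ (N - n) c * p := by rw [monomial_mul]
        obtain ⟨q, s, hqs, hs⟩ := ih (f - c • t) (by
          rw [degree_lt_iff] at hf ⊢
          intro k hk
          rcases hk.eq_or_lt with rfl | hlt
          · rw [coeff_sub, coeff_smul, hc, mul_assoc, inv_mul_cancel₀ hdeg.1, mul_one, sub_self]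
          · rw [coeff_sub, coeff_smul, hdeg.2 k hlt, hf k hlt, mul_zero, sub_zero])
        refine ⟨q + monomial δ (N - n) c, s, ?_, hs⟩
        rw [add_mul, ← hct, add_right_comm, ← hqs, sub_add_cancel]
  rcases eq_or_ne f 0 with rfl | hf
  · exact main 0 0 (by rw [(degree_eq_bot_iff 0).mpr rfl]; exact WithBot.bot_lt_coe 0)
  · obtain ⟨m, hm⟩ := exists_degree_eq hf
    exact main (m + 1) f (by rw [hm]; exact_mod_cast Nat.lt_succ_self m)

theorem degree_sub_lt {f g : SkewPoly δ} {d : WithBot ℕ} (hf : degree f < d) (hg : degree g < d) :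
    degree (f - g) < d := by
  induction d using WithBot.recBotCoe with
  | bot => exact absurd hf not_lt_bot
  | coe n =>
    rw [← Nat.cast_withBot, degree_lt_iff] at *
    intro k hk
    rw [coeff_sub, hf k hk, hg k hk, sub_zero]

theorem remainder_unique {p q q' s s' : SkewPoly δ} (h : q * p + s = q' * p + s')
    (hs : degree s < degree p) (hs' : degree s' < degree p) : s = s' := by
  have h1 : (q - q') * p = s' - s := by
    rw [sub_mul, sub_eq_sub_iff_add_eq_add, h, add_comm]
  have h2 := degree_sub_lt hs' hs
  rw [← h1] at h2
  rcases eq_or_ne p 0 with rfl | hp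
  · rw [(degree_eq_bot_iff (0 : SkewPoly δ)).mpr rfl] at hs
    exact absurd hs not_lt_bot
  rcases eq_or_ne (q - q') 0 with hq | hq
  · rw [hq, zero_mul] at h1
    exact (sub_eq_zero.mp h1.symm).symm
  obtain ⟨n, hn⟩ := exists_degree_eq hp
  obtain ⟨m, hm⟩ := exists_degree_eq hq
  rw [degree_mul hm hn, hn] at h2
  have : m + n < n := by exact_mod_cast h2
  omega

/-! ### Evaluation, zero sets and minimal skew polynomials -/

open Classical in
/-- The evaluation `F(P)`: the remainder of `f` in the right Euclidean division by `p`
(by convention `f` itself when `p = 0`). -/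
def eval (f p : SkewPoly δ) : SkewPoly δ :=
  if h : p = 0 then f else (exists_remainder f h).choose_spec.choose

/-- `p` divides `f` on the right. -/
def RightDvd (p f : SkewPoly δ) : Prop := ∃ g : SkewPoly δ, f = g * p

theorem eval_spec (f : SkewPoly δ) {p : SkewPoly δ} (hp : p ≠ 0) :
    ∃ q : SkewPoly δ, f = q * p + eval f p ∧ degree (eval f p) < degree p := by
  rw [eval, dif_neg hp]
  exact ⟨(exists_remainder f hp).choose, (exists_remainder f hp).choose_spec.choose_spec⟩

theorem eval_eq_zero_iff (f : SkewPoly δ) {p : SkewPoly δ} (hp : p ≠ 0) :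
    eval f p = 0 ↔ RightDvd p f := by
  obtain ⟨q, hq, hd⟩ := eval_spec f hp
  constructor
  · intro h
    rw [h, add_zero] at hq
    exact ⟨q, hq⟩
  · rintro ⟨g, hg⟩
    refine remainder_unique (p := p) (q := q) (q' := g) (by rw [← hq, hg, add_zero]) hd ?_
    rw [(degree_eq_bot_iff 0).mpr rfl]
    exact bot_lt_iff_ne_bot.mpr (mt (degree_eq_bot_iff p).mp hp)

/-- The left ideal `I(Ω)` of the skew polynomials vanishing at `Ω`. -/
def vanishing (Ω : Set (SkewPoly δ)) : Set (SkewPoly δ) := {f | ∀ p ∈ Ω, eval f p = 0}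

/-- The zero set of `A` in the universal set `U`. -/
def zeroSet (U A : Set (SkewPoly δ)) : Set (SkewPoly δ) := {p ∈ U | ∀ f ∈ A, eval f p = 0}

/-- `Ω` is algebraic. -/
def IsAlg (Ω : Set (SkewPoly δ)) : Prop := vanishing Ω ≠ {0}

/-- Leading coefficient `1`. -/
def IsMonic (f : SkewPoly δ) : Prop := ∃ n : ℕ, degree f = n ∧ coeff f n = 1

/-- `f` is a monic element of minimum degree among the non-zero elements of `I(Ω)`. -/
def IsMinimal (Ω : Set (SkewPoly δ)) (f : SkewPoly δ) : Prop :=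
  f ∈ vanishing Ω ∧ IsMonic f ∧ ∀ g ∈ vanishing Ω, g ≠ 0 → degree f ≤ degree g

theorem zero_mem_vanishing {Ω : Set (SkewPoly δ)} (hΩ : ∀ p ∈ Ω, p ≠ 0) :
    (0 : SkewPoly δ) ∈ vanishing Ω := fun p hp =>
  (eval_eq_zero_iff 0 (hΩ p hp)).mpr ⟨0, (zero_mul p).symm⟩

theorem mul_mem_vanishing {Ω : Set (SkewPoly δ)} (hΩ : ∀ p ∈ Ω, p ≠ 0) (g : SkewPoly δ)
    {f : SkewPoly δ} (hf : f ∈ vanishing Ω) : g * f ∈ vanishing Ω := fun p hp => by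
  obtain ⟨q, hq⟩ := (eval_eq_zero_iff f (hΩ p hp)).mp (hf p hp)
  exact (eval_eq_zero_iff _ (hΩ p hp)).mpr ⟨g * q, by rw [hq, mul_assoc]⟩

theorem sub_mem_vanishing {Ω : Set (SkewPoly δ)} (hΩ : ∀ p ∈ Ω, p ≠ 0)
    {f g : SkewPoly δ} (hf : f ∈ vanishing Ω) (hg : g ∈ vanishing Ω) :
    f - g ∈ vanishing Ω := fun p hp => by
  obtain ⟨q, hq⟩ := (eval_eq_zero_iff f (hΩ p hp)).mp (hf p hp)
  obtain ⟨s, hs⟩ := (eval_eq_zero_iff g (hΩ p hp)).mp (hg p hp)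
  exact (eval_eq_zero_iff _ (hΩ p hp)).mpr ⟨q - s, by rw [hq, hs, sub_mul]⟩

/-- The minimal skew polynomial of an algebraic set exists and is unique. -/
theorem existsUnique_isMinimal {Ω : Set (SkewPoly δ)} (hΩ : ∀ p ∈ Ω, p ≠ 0) (h : IsAlg Ω) :
    ∃! f : SkewPoly δ, IsMinimal Ω f := by
  have hne : ∃ n : ℕ, ∃ f ∈ vanishing Ω, degree f = n := by
    by_contra hcon
    push Not at hcon
    refine h (Set.eq_singleton_iff_unique_mem.mpr ⟨zero_mem_vanishing hΩ, fun f hf => ?_⟩)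
    by_contra hf0
    obtain ⟨n, hn⟩ := exists_degree_eq hf0
    exact hcon n f hf hn
  classical
  obtain ⟨f, hf, hfd⟩ := Nat.find_spec hne
  set n := Nat.find hne with hn_def
  have hmin : ∀ g ∈ vanishing Ω, g ≠ 0 → (n : WithBot ℕ) ≤ degree g := by
    intro g hg hg0
    obtain ⟨k, hk⟩ := exists_degree_eq hg0
    rw [hk]
    exact_mod_cast Nat.find_min' hne ⟨g, hg, hk⟩
  have hlead := coeff_ne_zero_of_degree_eq hfd
  have hdeg : degree ((coeff f n)⁻¹ • f) = n := by
    rw [degree_eq_iff] at hfd ⊢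
    refine ⟨?_, fun k hk => ?_⟩
    · rw [coeff_smul]; exact mul_ne_zero (inv_ne_zero hlead) hlead
    · rw [coeff_smul, hfd.2 k hk, mul_zero]
  refine ⟨(coeff f n)⁻¹ • f, ⟨?_, ⟨n, hdeg, ?_⟩, ?_⟩, ?_⟩
  · rw [smul_eq]; exact mul_mem_vanishing hΩ _ hf
  · rw [coeff_smul]; exact inv_mul_cancel₀ hlead
  · rw [hdeg]; exact hmin
  · rintro g ⟨hg, ⟨k, hk, hk1⟩, hgmin⟩
    have hg0 : g ≠ 0 := fun h0 => by
      rw [h0, coeff_zero] at hk1; exact zero_ne_one hk1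
    have h0' : (coeff f n)⁻¹ • f ∈ vanishing Ω := by
      rw [smul_eq]; exact mul_mem_vanishing hΩ _ hf
    have hf0 : (coeff f n)⁻¹ • f ≠ 0 := fun h0 => by
      rw [h0, (degree_eq_bot_iff 0).mpr rfl] at hdeg; exact WithBot.bot_ne_coe hdeg
    have hkn : k = n := by
      have a1 := hmin g hg hg0
      have a2 := hgmin _ h0' hf0
      rw [hk] at a1 a2
      rw [hdeg] at a2
      exact le_antisymm (by exact_mod_cast a2) (by exact_mod_cast a1)
    subst hkn
    by_contra hcon
    have hsub := hmin _ (sub_mem_vanishing hΩ hg h0') (sub_ne_zero.mpr hcon)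
    refine absurd hsub (not_le.mpr ((degree_lt_iff _ _).mpr fun j hj => ?_))
    rcases hj.eq_or_lt with rfl | hlt
    · rw [coeff_sub, hk1, coeff_smul, inv_mul_cancel₀ hlead, sub_self]
    · rw [coeff_sub, ((degree_eq_iff _ _).mp hk).2 j hlt,
        ((degree_eq_iff _ _).mp hdeg).2 j hlt, sub_zero]

open Classical in
/-- The minimal skew polynomial `F_Ω`, which is `0` when `Ω` is not algebraic. -/
def minPoly (Ω : Set (SkewPoly δ)) : SkewPoly δ :=
  if h : ∃ f : SkewPoly δ, IsMinimal Ω f then h.choose else 0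

/-- The rank of a P-closed set. -/
def rank (Ω : Set (SkewPoly δ)) : WithBot ℕ := degree (minPoly Ω)

/-- `Ψ ≤ Ω`: any `n` distinct elements of `Ψ` right-divide, respectively, some `n` distinct
elements of `Ω`. -/
def Precedes (Ψ Ω : Set (SkewPoly δ)) : Prop :=
  ∀ S : Finset (SkewPoly δ), S.Nonempty → (S : Set (SkewPoly δ)) ⊆ Ψ →
    ∃ g : SkewPoly δ → SkewPoly δ, Set.InjOn g S ∧ ∀ q ∈ S, g q ∈ Ω ∧ RightDvd q (g q)

/-- P-independence: finite, algebraic, and the degree of the minimal skew polynomial is the sum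
of the degrees. -/
def IsPIndep (Ω : Set (SkewPoly δ)) : Prop :=
  IsAlg Ω ∧ ∃ S : Finset (SkewPoly δ), (S : Set (SkewPoly δ)) = Ω ∧
    degree (minPoly Ω) = ∑ p ∈ S, degree p

/-- The P-closure of `Ω` in `U`. -/
def pClosure (U Ω : Set (SkewPoly δ)) : Set (SkewPoly δ) := zeroSet U (vanishing Ω)

/-- `Ω` is P-closed in `U`. -/
def IsPClosed (U Ω : Set (SkewPoly δ)) : Prop := pClosure U Ω = Ω

/-- `B` is a P-basis of the P-closed subset `Ω` of `U`. -/
def IsPBasis (U B Ω : Set (SkewPoly δ)) : Prop :=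
  IsPClosed U Ω ∧ B ⊆ U ∧ Precedes B Ω ∧ IsPIndep B ∧ pClosure U B = Ω

/-! ### Conjugacy classes and multiplicity sequences -/

/-- The `(σ, δ)`-conjugacy class of `a`. -/
def conjClass (δ : SkewDerivation σ) (a : F) : Set F :=
  {b | ∃ β : F, β ≠ 0 ∧ b = σ β * a * β⁻¹ + δ.toFun β * β⁻¹}

/-- The linear skew polynomial `x - a`. -/
def linear (δ : SkewDerivation σ) (a : F) : SkewPoly δ := X δ - const δ a

/-- A subset of `F`, seen as a set of linear skew polynomials. -/
def points (δ : SkewDerivation σ) (S : Set F) : Set (SkewPoly δ) := linear δ '' S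

/-- The universal set of all `x - a`. -/
def linearUniv (δ : SkewDerivation σ) : Set (SkewPoly δ) := Set.range (linear δ)

/-- `P_a = (x - a_r) ⋯ (x - a_2) (x - a_1)` for `a = (a_1, …, a_r)`; the indices of `Fin r`
start at `0`. -/
def seqPoly (δ : SkewDerivation σ) {r : ℕ} (a : Fin r → F) : SkewPoly δ :=
  ((List.ofFn a).reverse.map (linear δ)).prod

/-- `a = (a_1, …, a_r)`, `r ≥ 1`, is a multiplicity sequence: `a_1` is the only zero of `P_a`. -/
def IsMultSeq (δ : SkewDerivation σ) {r : ℕ} (a : Fin r → F) : Prop :=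
  ∃ h : 0 < r, {c : F | eval (seqPoly δ a) (linear δ c) = 0} = {a ⟨0, h⟩}

/-- The universal set of all `P_a` with `a` a multiplicity sequence. -/
def multUniv (δ : SkewDerivation σ) : Set (SkewPoly δ) :=
  {p | ∃ (r : ℕ) (a : Fin r → F), IsMultSeq δ a ∧ p = seqPoly δ a}

/-- The conjugacy class of `a` with multiplicity `r`: all `P_b` with `b` a multiplicity sequence
of length `i`, `1 ≤ i ≤ r`, starting in the conjugacy class of `a`. -/
def multConjClass (δ : SkewDerivation σ) (r : ℕ) (a : F) : Set (SkewPoly δ) :=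
  {p | ∃ (i : ℕ) (hi : 0 < i) (b : Fin i → F), i ≤ r ∧ IsMultSeq δ b ∧
    b ⟨0, hi⟩ ∈ conjClass δ a ∧ p = seqPoly δ b}

end

end SkewPoly

/-! Write R for the skew polynomial ring and f for the minimal polynomial of C(a), of degree m.
Right division makes I(Ω), the intersection of the left ideals RP for P in Ω, principal with
generator F_Ω when Ω is algebraic, and gives dim_F(R/Rp) = deg p. The theorem thus becomes one about
left ideals and their codimensions.

Three facts carry it. First, Rf is the annihilator of the simple module R/R(x-a), hence two-sided: f
h = h' f for every h (`exists_classPoly_mul_eq`). Moreover the maximal left ideals containing a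
power of f are the R(x-c) with c in C(a). Second, a maximal left ideal containing a product of
linear factors is some R(x-c), so for a multiplicity sequence b the module R/RP_b is local: R(x-b_1)
is the only maximal left ideal over RP_b (`IsMultSeq.eq_of_isCoatom`). Third, by Nakayama, if R maps
onto the product of the R/R(x-p_i), it maps onto the product of the R/RP_i for multiplicity
sequences starting at the p_i; so degrees add up in the least left common multiple
(`codim_iInf_span_seqPoly`).

Item 1 is an induction on r: f can be moved past any cofactor and absorbs x-b_r, provided that b_r
lies in C(a). That it does (`IsMultSeq.last_mem_conjClass`) follows from locality, since different
classes give comaximal ideals. Item 2 compares codimensions: f^r is a common multiple of the P_i,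
and the least one has degree rm.

For item 3, C_r(a) is shown to consist of the elements of U_2 that right-divide f^r
(`mem_multConjClass_iff`). The bound on the length is again a degree count, in a family of
multiplicity sequences over a P-basis through b_1. It needs multiplicity sequences of every length
from every point (`IsMultSeq.exists_snoc`). -/

/-! ### Codimension of submodules over a division ring -/

section Codimension

variable (K : Type*) {R M : Type*} [DivisionRing K] [Ring R] [Module K R] [AddCommGroup M]
  [Module R M] [Module K M] [IsScalarTower K R M]

/-- The dimension over `K` of the quotient of `M` by an `R`-submodule. -/
noncomputable def Submodule.codim (N : Submodule R M) : ℕ := Module.finrank K (M ⧸ N)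

theorem Submodule.finite_quotient_of_le {N N' : Submodule R M} (h : N ≤ N')
    [Module.Finite K (M ⧸ N)] : Module.Finite K (M ⧸ N') :=
  Module.Finite.of_surjective ((Submodule.factor h).restrictScalars K)
    (Submodule.factor_surjective h)

theorem Submodule.codim_anti {N N' : Submodule R M} (h : N ≤ N') [Module.Finite K (M ⧸ N)] :
    N'.codim K ≤ N.codim K :=
  LinearMap.finrank_le_finrank_of_surjective (f := (Submodule.factor h).restrictScalars K)
    (Submodule.factor_surjective h)

theorem Submodule.eq_of_le_of_codim_le {N N' : Submodule R M} (h : N ≤ N')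
    [Module.Finite K (M ⧸ N)] (hd : N.codim K ≤ N'.codim K) : N = N' := by
  have := Submodule.finite_quotient_of_le K h
  have hinj := (LinearMap.injective_iff_surjective_of_finrank_eq_finrank
    (le_antisymm hd (Submodule.codim_anti K h))
    (f := (Submodule.factor h).restrictScalars K)).mpr (Submodule.factor_surjective h)
  refine le_antisymm h fun x hx => ?_
  have h0 : Submodule.factor h (N.mkQ x) = Submodule.factor h (N.mkQ 0) := by
    rw [Submodule.factor_mk, Submodule.factor_mk]
    simpa using hx
  have := hinj h0
  simpa using this

theorem Submodule.codim_top : (⊤ : Submodule R M).codim K = 0 :=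
  Module.finrank_zero_of_subsingleton

theorem Submodule.codim_eq_zero_iff (N : Submodule R M) [Module.Finite K (M ⧸ N)] :
    N.codim K = 0 ↔ N = ⊤ := by
  refine ⟨fun h => Submodule.eq_of_le_of_codim_le K le_top (h.le.trans (Nat.zero_le _)), ?_⟩
  rintro rfl
  exact Submodule.codim_top K

variable {ι : Type*}

theorem Submodule.ker_pi_mkQ (N : ι → Submodule R M) :
    LinearMap.ker (LinearMap.pi fun i => (N i).mkQ) = ⨅ i, N i := by
  rw [LinearMap.ker_pi]
  simp

theorem Submodule.codim_iInf (N : ι → Submodule R M) :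
    (⨅ i, N i).codim K = Module.finrank K
      (LinearMap.range ((LinearMap.pi fun i => (N i).mkQ).restrictScalars K)) := by
  rw [← Submodule.ker_pi_mkQ]
  exact LinearEquiv.finrank_eq
    ((LinearMap.quotKerEquivRange (LinearMap.pi fun i => (N i).mkQ)).restrictScalars K)

variable [Fintype ι]

theorem Submodule.codim_iInf_le (N : ι → Submodule R M) [∀ i, Module.Finite K (M ⧸ N i)] :
    (⨅ i, N i).codim K ≤ ∑ i, (N i).codim K := by
  rw [Submodule.codim_iInf]
  exact (Submodule.finrank_le _).trans (Module.finrank_pi_fintype K).le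

/-- The quotient by the intersection embeds in the product of the quotients, whose dimension is the
sum; equality of dimensions is surjectivity. This Chinese remainder form turns additivity of degrees
into a lifting problem. -/
theorem Submodule.codim_iInf_eq_sum_iff (N : ι → Submodule R M)
    [∀ i, Module.Finite K (M ⧸ N i)] :
    (⨅ i, N i).codim K = ∑ i, (N i).codim K ↔
      Function.Surjective (LinearMap.pi fun i => (N i).mkQ) := by
  rw [Submodule.codim_iInf]
  have hs : ∑ i, (N i).codim K = Module.finrank K (∀ i, M ⧸ N i) :=
    (Module.finrank_pi_fintype K).symm
  rw [hs]
  constructor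
  · intro h
    exact LinearMap.range_eq_top (f := (LinearMap.pi fun i => (N i).mkQ).restrictScalars K) |>.mp
      (Submodule.eq_top_of_finrank_eq h)
  · intro h
    rw [(LinearMap.range_eq_top
      (f := (LinearMap.pi fun i => (N i).mkQ).restrictScalars K)).mpr h, finrank_top]

theorem Submodule.codim_inf_le (N N' : Submodule R M) [Module.Finite K (M ⧸ N)]
    [Module.Finite K (M ⧸ N')] : (N ⊓ N').codim K ≤ N.codim K + N'.codim K := by
  have : ∀ b : Bool, Module.Finite K (M ⧸ (cond b N N')) := by rintro (_ | _) <;> assumption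
  simpa [iInf_bool_eq] using Submodule.codim_iInf_le K fun b : Bool => cond b N N'

theorem Submodule.codim_inf_eq_add_iff (N N' : Submodule R M) [Module.Finite K (M ⧸ N)]
    [Module.Finite K (M ⧸ N')] : (N ⊓ N').codim K = N.codim K + N'.codim K ↔ N ⊔ N' = ⊤ := by
  have : ∀ b : Bool, Module.Finite K (M ⧸ (cond b N N')) := by rintro (_ | _) <;> assumption
  have h := Submodule.codim_iInf_eq_sum_iff K fun b : Bool => cond b N N'
  simp only [iInf_bool_eq, Fintype.sum_bool, cond_true, cond_false] at h
  rw [h]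
  constructor
  · intro hs
    rw [eq_top_iff]
    intro x _
    -- A lift y of the pair (x, 0) lies in `N'` and differs from x by an element of `N`.
    obtain ⟨y, hy⟩ := hs fun b => Bool.rec (motive := fun b => M ⧸ (cond b N N')) 0 (N.mkQ x) b
    have h1 : N.mkQ y = N.mkQ x := congrFun hy true
    have h2 : N'.mkQ y = 0 := congrFun hy false
    rw [← sub_eq_zero, ← map_sub, Submodule.mkQ_apply, Submodule.Quotient.mk_eq_zero] at h1
    rw [Submodule.mkQ_apply, Submodule.Quotient.mk_eq_zero] at h2
    have := Submodule.sub_mem_sup h2 h1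
    rw [sub_sub_cancel, sup_comm] at this
    exact this
  · intro ht y
    obtain ⟨u, hu⟩ := N.mkQ_surjective (y true)
    obtain ⟨v, hv⟩ := N'.mkQ_surjective (y false)
    obtain ⟨n, hn, n', hn', hnn⟩ := Submodule.mem_sup.mp (ht ▸ Submodule.mem_top : v - u ∈ N ⊔ N')
    -- Since v - u = n + n', the element u + n equals v - n': it is congruent to u modulo `N` and to
    -- v modulo `N'`.
    refine ⟨u + n, funext fun b => ?_⟩
    cases b
    · refine Eq.trans ?_ hv
      change N'.mkQ (u + n) = N'.mkQ v
      rw [← sub_eq_zero, ← map_sub, Submodule.mkQ_apply, Submodule.Quotient.mk_eq_zero]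
      have : u + n - v = -n' := by
        rw [eq_neg_iff_add_eq_zero, sub_add_eq_add_sub, add_assoc, hnn]; abel
      rw [this]
      exact neg_mem hn'
    · refine Eq.trans ?_ hu
      change N.mkQ (u + n) = N.mkQ u
      rw [map_add, Submodule.mkQ_apply, Submodule.mkQ_apply, (Submodule.Quotient.mk_eq_zero _).mpr hn,
        add_zero]

end Codimension

/-! ### Lifting surjectivity along the Jacobson radical -/

section Nakayama

variable {R M : Type*} [Ring R] [AddCommGroup M] [Module R M] [Module.Finite R M]

/-- If every maximal submodule over `N i` contains `N' i` and `M` maps onto the product of the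
quotients `M ⧸ N' i`, then it maps onto the product of the quotients `M ⧸ N i`. -/
theorem Submodule.surjective_pi_mkQ_of_isCoatom {ι : Type*} [Finite ι] {N N' : ι → Submodule R M}
    (h : ∀ i (L : Submodule R M), IsCoatom L → N i ≤ L → N' i ≤ L)
    (hs : Function.Surjective (LinearMap.pi fun i => (N' i).mkQ)) :
    Function.Surjective (LinearMap.pi fun i => (N i).mkQ) := by
  classical
  have := Fintype.ofFinite ι
  -- The maximal submodules of `M ⧸ N i` are those of `M` over `N i`, and all of these contain `N'
  -- i`.
  have hmap : ∀ i, (N' i).map (N i).mkQ ≤ Module.jacobson R (M ⧸ N i) := by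
    intro i
    refine le_sInf fun L hL => ?_
    rw [Submodule.map_le_iff_le_comap]
    refine h i _ ?_ ?_
    · exact (Submodule.isCoatom_comap_iff (N i).mkQ_surjective).mpr hL
    · intro x hx
      rw [Submodule.mem_comap, Submodule.mkQ_apply, (Submodule.Quotient.mk_eq_zero _).mpr hx]
      exact zero_mem _
  rw [← LinearMap.range_eq_top]
  -- Nakayama: the product is finitely generated, so it suffices that the range and the radical
  -- together span it. Lifting y modulo the `N' i` leaves an error whose coordinates come from the
  -- `N' i`.
  refine Order.radical_nongenerating (eq_top_iff.mpr fun y _ => ?_)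
  choose z hz using fun i => (N i).mkQ_surjective (y i)
  obtain ⟨u, hu⟩ := hs fun i => (N' i).mkQ (z i)
  have hy : y = (LinearMap.pi fun i => (N i).mkQ) u + (y - (LinearMap.pi fun i => (N i).mkQ) u) := by
    abel
  rw [hy]
  refine Submodule.add_mem_sup ⟨u, rfl⟩ ?_
  have hrad : Module.jacobson R (∀ i, M ⧸ N i) = Order.radical (Submodule R (∀ i, M ⧸ N i)) := by
    rw [Module.jacobson, Order.radical, sInf_eq_iInf]
  rw [← hrad, ← Finset.univ_sum_single (y - (LinearMap.pi fun i => (N i).mkQ) u)]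
  refine sum_mem fun i _ => ?_
  refine Module.map_jacobson_le (LinearMap.single R (fun i => M ⧸ N i) i)
    (Submodule.mem_map_of_mem (hmap i ⟨z i - u, ?_, ?_⟩))
  · have := congrFun hu i
    change (N' i).mkQ u = (N' i).mkQ (z i) at this
    have := sub_eq_zero.mpr this.symm
    rwa [← map_sub, Submodule.mkQ_apply, Submodule.Quotient.mk_eq_zero] at this
  · rw [map_sub, hz]
    rfl

end Nakayama

/-! ### Degrees, principal left ideals and their generators -/

namespace SkewPoly

variable {F : Type*} [DivisionRing F] {σ : F →+* F} {δ : SkewDerivation σ}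

/-- Makes every left ideal an F-subspace, so that its codimension over F makes sense. -/
instance : IsScalarTower F (SkewPoly δ) (SkewPoly δ) := ⟨fun c f g => smul_mul' c f g⟩

/-! ### Monic skew polynomials and their degrees -/

theorem degree_linear (c : F) : degree (linear δ c) = (1 : ℕ) := by
  rw [degree_eq_iff]
  constructor
  · simp [linear, X, const, coeff_monomial]
  · intro k hk
    have h1 : 1 ≠ k := by omega
    have h0 : 0 ≠ k := by omega
    simp [linear, X, const, coeff_monomial, h1, h0]

theorem ne_zero_of_degree_eq {f : SkewPoly δ} {n : ℕ} (h : degree f = n) : f ≠ 0 := by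
  rintro rfl
  exact coeff_ne_zero_of_degree_eq h rfl

theorem linear_ne_zero (c : F) : linear δ c ≠ 0 := ne_zero_of_degree_eq (degree_linear c)

theorem degree_one : degree (1 : SkewPoly δ) = (0 : ℕ) := by
  rw [degree_eq_iff]
  change coeff (monomial δ 0 1) 0 ≠ 0 ∧ ∀ k, 0 < k → coeff (monomial δ 0 1) k = 0
  refine ⟨by simp [coeff_monomial], fun k hk => ?_⟩
  simp [coeff_monomial, hk.ne]

theorem coeff_one_zero : coeff (1 : SkewPoly δ) 0 = 1 := by
  change coeff (monomial δ 0 1) 0 = 1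
  simp [coeff_monomial]

theorem coeff_xMul_iterate {f : SkewPoly δ} {n : ℕ} (h : degree f = n) (h1 : coeff f n = 1)
    (k : ℕ) : coeff ((xMul δ)^[k] f) (k + n) = 1 := by
  induction k with
  | zero => simpa using h1
  | succ k ih =>
    have hd := degree_xMul_iterate h k
    rw [degree_eq_iff] at hd
    have h0 : δ.toFun 0 = 0 := δ.map_zero'
    rw [Function.iterate_succ_apply', show k + 1 + n = k + n + 1 by omega, coeff_xMul_succ, ih,
      hd.2 _ (Nat.lt_succ_self _), h0, add_zero, map_one]

theorem coeff_mul_add {f g : SkewPoly δ} {m n : ℕ} (hf : degree f = m) (hf1 : coeff f m = 1)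
    (hg : degree g = n) (hg1 : coeff g n = 1) : coeff (f * g) (m + n) = 1 := by
  have key : ∀ k, coeff (f * g) k =
      ∑ i ∈ (coeffs f).support, coeff f i * coeff ((xMul δ)^[i] g) k :=
    fun k => Finsupp.finsetSum_apply _ _ _
  rw [key, Finset.sum_eq_single m, hf1, one_mul, coeff_xMul_iterate hg hg1]
  · intro i hi him
    have := Finset.le_max hi
    rw [show (coeffs f).support.max = (m : WithBot ℕ) from hf] at this
    have : i ≤ m := WithBot.coe_le_coe.mp this
    rw [((degree_eq_iff _ _).mp (degree_xMul_iterate hg i)).2 _ (by omega), mul_zero]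
  · intro hm
    exact absurd (Finset.mem_of_max hf) hm

instance : NoZeroDivisors (SkewPoly δ) := ⟨fun {f g} h => by
  by_contra! hne
  obtain ⟨m, hm⟩ := exists_degree_eq hne.1
  obtain ⟨n, hn⟩ := exists_degree_eq hne.2
  exact ne_zero_of_degree_eq (degree_mul hm hn) h⟩

instance : Nontrivial (SkewPoly δ) := ⟨⟨1, 0, ne_zero_of_degree_eq degree_one⟩⟩

theorem degree_pow {f : SkewPoly δ} {m : ℕ} (hf : degree f = m) (r : ℕ) :
    degree (f ^ r) = ((r * m : ℕ) : WithBot ℕ) := by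
  induction r with
  | zero => simpa using degree_one (δ := δ)
  | succ r ih => rw [pow_succ, degree_mul ih hf, Nat.succ_mul]

theorem coeff_pow_mul {f : SkewPoly δ} {m : ℕ} (hf : degree f = m) (hf1 : coeff f m = 1) (r : ℕ) :
    coeff (f ^ r) (r * m) = 1 := by
  induction r with
  | zero => simpa using coeff_one_zero (δ := δ)
  | succ r ih => rw [pow_succ, Nat.succ_mul, coeff_mul_add (degree_pow hf r) ih hf hf1]

theorem isMonic_pow {f : SkewPoly δ} (hf : IsMonic f) (r : ℕ) : IsMonic (f ^ r) := by
  obtain ⟨m, hm, h1⟩ := hf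
  exact ⟨r * m, degree_pow hm r, coeff_pow_mul hm h1 r⟩

theorem IsMonic.ne_zero {f : SkewPoly δ} (hf : IsMonic f) : f ≠ 0 := by
  obtain ⟨m, hm, -⟩ := hf
  exact ne_zero_of_degree_eq hm

/-! ### The product `(x - a_r) ⋯ (x - a_1)` -/

theorem seqPoly_succ {r : ℕ} (b : Fin (r + 1) → F) :
    seqPoly δ b = linear δ (b (Fin.last r)) * seqPoly δ (fun i : Fin r => b i.castSucc) := by
  rw [seqPoly, List.ofFn_succ', List.concat_eq_append, List.reverse_append]
  simp only [List.reverse_singleton, List.singleton_append, List.map_cons, List.prod_cons]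
  rfl

theorem seqPoly_zero (b : Fin 0 → F) : seqPoly δ b = 1 := by
  simp [seqPoly]

theorem degree_seqPoly {r : ℕ} (b : Fin r → F) : degree (seqPoly δ b) = r := by
  induction r with
  | zero => rw [seqPoly_zero]; exact degree_one
  | succ r ih => rw [seqPoly_succ, degree_mul (degree_linear _) (ih _), add_comm]

theorem seqPoly_ne_zero {r : ℕ} (b : Fin r → F) : seqPoly δ b ≠ 0 :=
  ne_zero_of_degree_eq (degree_seqPoly b)

/-! ### Principal left ideals and their codimensions -/

theorem rightDvd_iff_mem_span {p f : SkewPoly δ} : RightDvd p f ↔ f ∈ Ideal.span {p} := by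
  rw [Ideal.mem_span_singleton']
  exact ⟨fun ⟨g, hg⟩ => ⟨g, hg.symm⟩, fun ⟨g, hg⟩ => ⟨g, hg.symm⟩⟩

theorem eval_eq_zero_iff_mem {f p : SkewPoly δ} (hp : p ≠ 0) :
    eval f p = 0 ↔ f ∈ Ideal.span {p} :=
  (eval_eq_zero_iff f hp).trans rightDvd_iff_mem_span

/-- The skew polynomial of degree less than `n` with given coefficients. -/
noncomputable def ofCoeffs (δ : SkewDerivation σ) (n : ℕ) : (Fin n → F) →ₗ[F] SkewPoly δ where
  toFun v := ∑ i, v i • monomial δ i 1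
  map_add' v w := by simp [add_smul, Finset.sum_add_distrib]
  map_smul' c v := by simp [mul_smul, Finset.smul_sum]

theorem coeff_sum {ι : Type*} (s : Finset ι) (f : ι → SkewPoly δ) (k : ℕ) :
    coeff (∑ i ∈ s, f i) k = ∑ i ∈ s, coeff (f i) k :=
  Finsupp.finsetSum_apply _ _ _

theorem coeff_ofCoeffs (n : ℕ) (v : Fin n → F) (k : ℕ) :
    coeff (ofCoeffs δ n v) k = if h : k < n then v ⟨k, h⟩ else 0 := by
  change coeff (∑ i, v i • monomial δ i 1) k = _
  rw [coeff_sum]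
  split_ifs with h
  · rw [Finset.sum_eq_single ⟨k, h⟩]
    · simp [coeff_monomial]
    · intro i _ hi
      have : (i : ℕ) ≠ k := fun hik => hi (Fin.ext hik)
      simp [coeff_monomial, this]
    · simp
  · refine Finset.sum_eq_zero fun i _ => ?_
    have : (i : ℕ) ≠ k := by have := i.2; omega
    simp [coeff_monomial, this]

/-- By right division, each coset of the left ideal has exactly one representative of degree less
than n. -/
theorem bijective_mkQ_ofCoeffs {p : SkewPoly δ} {n : ℕ} (hp : degree p = n) :
    Function.Bijective
      (((Ideal.span {p} : Ideal (SkewPoly δ)).mkQ.restrictScalars F).comp (ofCoeffs δ n)) := by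
  have hlt : ∀ v, degree (ofCoeffs δ n v) < degree p := by
    intro v
    rw [hp, degree_lt_iff]
    intro k hk
    rw [coeff_ofCoeffs, dif_neg (not_lt.mpr hk)]
  constructor
  · refine (injective_iff_map_eq_zero _).mpr fun v hv => ?_
    have hv' : ofCoeffs δ n v ∈ Ideal.span {p} := (Submodule.Quotient.mk_eq_zero _).mp hv
    obtain ⟨q, hq⟩ := Ideal.mem_span_singleton'.mp hv'
    have h0 : ofCoeffs δ n v = 0 := by
      refine remainder_unique (p := p) (q := 0) (q' := q) (by rw [hq]; simp) (hlt v) ?_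
      rw [(degree_eq_bot_iff 0).mpr rfl, hp]
      exact WithBot.bot_lt_coe n
    funext i
    have := coeff_ofCoeffs (δ := δ) n v i
    rw [h0, dif_pos i.2] at this
    exact this.symm
  · intro y
    obtain ⟨g, rfl⟩ := Submodule.mkQ_surjective _ y
    obtain ⟨q, s, hg, hs⟩ := exists_remainder g (ne_zero_of_degree_eq hp)
    refine ⟨fun i => coeff s i, ?_⟩
    have hsv : ofCoeffs δ n (fun i => coeff s i) = s := by
      ext k
      rw [coeff_ofCoeffs]
      split_ifs with h
      · rfl
      · rw [hp, degree_lt_iff] at hs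
        exact (hs k (not_lt.mp h)).symm
    change (Ideal.span {p} : Ideal (SkewPoly δ)).mkQ (ofCoeffs δ n _) = _
    rw [hsv, hg, map_add, Submodule.mkQ_apply _ (q * p),
      (Submodule.Quotient.mk_eq_zero _).mpr (Ideal.mem_span_singleton'.mpr ⟨q, rfl⟩), zero_add]

theorem finite_quotient_span {p : SkewPoly δ} (hp : p ≠ 0) :
    Module.Finite F (SkewPoly δ ⧸ Ideal.span {p}) := by
  obtain ⟨n, hn⟩ := exists_degree_eq hp
  exact Module.Finite.equiv (LinearEquiv.ofBijective _ (bijective_mkQ_ofCoeffs hn))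

theorem codim_span {p : SkewPoly δ} {n : ℕ} (hp : degree p = n) :
    (Ideal.span {p} : Ideal (SkewPoly δ)).codim F = n := by
  rw [Submodule.codim]
  refine (LinearEquiv.finrank_eq (LinearEquiv.ofBijective _ (bijective_mkQ_ofCoeffs hp))).symm.trans
    ?_
  simp

theorem finite_quotient_of_mem {J : Ideal (SkewPoly δ)} {p : SkewPoly δ} (hp : p ≠ 0)
    (h : p ∈ J) : Module.Finite F (SkewPoly δ ⧸ J) := by
  have := finite_quotient_span hp
  exact Submodule.finite_quotient_of_le F ((Ideal.span_singleton_le_iff_mem J).mpr h)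

instance (c : F) : Module.Finite F (SkewPoly δ ⧸ Ideal.span {linear δ c}) :=
  finite_quotient_span (linear_ne_zero c)

instance {r : ℕ} (b : Fin r → F) : Module.Finite F (SkewPoly δ ⧸ Ideal.span {seqPoly δ b}) :=
  finite_quotient_span (seqPoly_ne_zero b)

/-! ### Minimal skew polynomials as generators -/

theorem mem_vanishing_iff {Ω : Set (SkewPoly δ)} (hΩ : ∀ p ∈ Ω, p ≠ 0) {f : SkewPoly δ} :
    f ∈ vanishing Ω ↔ ∀ p ∈ Ω, f ∈ Ideal.span {p} :=
  forall₂_congr fun p hp => eval_eq_zero_iff_mem (hΩ p hp)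

theorem isMinimal_minPoly {Ω : Set (SkewPoly δ)} (hΩ : ∀ p ∈ Ω, p ≠ 0) (h : IsAlg Ω) :
    IsMinimal Ω (minPoly Ω) := by
  have hex := (existsUnique_isMinimal hΩ h).exists
  rw [minPoly, dif_pos hex]
  exact hex.choose_spec

theorem isAlg_of_mem {Ω : Set (SkewPoly δ)} {f : SkewPoly δ} (hf : f ≠ 0)
    (h : f ∈ vanishing Ω) : IsAlg Ω := fun h0 => hf (by rw [h0] at h; exact h)

theorem mem_vanishing_iff_mem_span_minPoly {Ω : Set (SkewPoly δ)} (hΩ : ∀ p ∈ Ω, p ≠ 0)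
    (h : IsAlg Ω) {g : SkewPoly δ} : g ∈ vanishing Ω ↔ g ∈ Ideal.span {minPoly Ω} := by
  obtain ⟨hm, hmon, hmin⟩ := isMinimal_minPoly hΩ h
  rw [Ideal.mem_span_singleton']
  constructor
  · intro hg
    obtain ⟨q, s, hqs, hs⟩ := exists_remainder g hmon.ne_zero
    have hsv : s ∈ vanishing Ω := by
      have : s = g - q * minPoly Ω := by rw [hqs, add_sub_cancel_left]
      rw [this]
      exact sub_mem_vanishing hΩ hg (mul_mem_vanishing hΩ q hm)
    have hs0 : s = 0 := by
      by_contra hne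
      exact absurd (hmin s hsv hne) (not_le.mpr hs)
    exact ⟨q, by rw [hqs, hs0, add_zero]⟩
  · rintro ⟨q, rfl⟩
    exact mul_mem_vanishing hΩ q hm

theorem degree_le_of_mem_span {f g : SkewPoly δ} (hf : g ∈ Ideal.span {f}) (hg : g ≠ 0) :
    degree f ≤ degree g := by
  obtain ⟨q, rfl⟩ := Ideal.mem_span_singleton'.mp hf
  obtain ⟨m, hm⟩ := exists_degree_eq (left_ne_zero_of_mul hg)
  obtain ⟨n, hn⟩ := exists_degree_eq (right_ne_zero_of_mul hg)
  rw [degree_mul hm hn, hn]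
  exact_mod_cast Nat.le_add_left n m

theorem minPoly_eq_of_vanishing {Ω : Set (SkewPoly δ)} (hΩ : ∀ p ∈ Ω, p ≠ 0) {f : SkewPoly δ}
    (hf : IsMonic f) (h : ∀ g, g ∈ vanishing Ω ↔ g ∈ Ideal.span {f}) : minPoly Ω = f := by
  have hmem : f ∈ vanishing Ω := (h f).mpr (Ideal.mem_span_singleton_self f)
  have halg := isAlg_of_mem hf.ne_zero hmem
  exact (existsUnique_isMinimal hΩ halg).unique (isMinimal_minPoly hΩ halg)
    ⟨hmem, hf, fun g hg hg0 => degree_le_of_mem_span ((h g).mp hg) hg0⟩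

end SkewPoly

/-! ### Conjugacy, maximal left ideals and locality of multiplicity sequences -/

namespace SkewPoly

variable {F : Type*} [DivisionRing F] {σ : F →+* F} {δ : SkewDerivation σ}

/-! ### Conjugacy -/

theorem const_mul_const (c d : F) : const δ c * const δ d = const δ (c * d) := by
  rw [← smul_eq]
  ext k
  simp [const, coeff_monomial]

theorem const_one : const δ 1 = 1 := rfl

theorem const_zero : const δ 0 = 0 := by
  ext k
  simp [const, coeff_monomial]

theorem const_ne_zero {c : F} (hc : c ≠ 0) : const δ c ≠ 0 := fun h => by
  have := congrArg (fun f => coeff f 0) h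
  simp [const, coeff_monomial] at this
  exact hc this

theorem coeff_neg (f : SkewPoly δ) (k : ℕ) : coeff (-f) k = -coeff f k := rfl

theorem linear_mul_const_eq_iff {a c β : F} :
    linear δ c * const δ β = const δ (σ β) * linear δ a ↔ c * β = σ β * a + δ.toFun β := by
  rw [linear, linear, sub_mul, mul_sub, X_mul_const, const_mul_const, const_mul_const,
    add_sub_assoc, sub_eq_add_neg (const δ (σ β) * X δ), add_right_inj]
  constructor
  · intro h
    have := congrArg (fun f => coeff f 0) h
    simp only [coeff_sub, coeff_neg, const, coeff_monomial, if_true] at this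
    rw [sub_eq_iff_eq_add, neg_add_eq_sub, eq_sub_iff_add_eq, add_comm] at this
    exact this.symm
  · intro h
    rw [h]
    ext k
    simp only [coeff_sub, coeff_neg, const, coeff_monomial]
    split_ifs <;> simp

theorem mem_conjClass_iff {a c : F} :
    c ∈ conjClass δ a ↔ ∃ β : F, β ≠ 0 ∧ linear δ c * const δ β = const δ (σ β) * linear δ a := by
  refine exists_congr fun β => and_congr_right fun hβ => ?_
  rw [linear_mul_const_eq_iff, ← add_mul, eq_mul_inv_iff_mul_eq₀ hβ]

theorem self_mem_conjClass (a : F) : a ∈ conjClass δ a :=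
  mem_conjClass_iff.mpr ⟨1, one_ne_zero, by simp [const_one]⟩

theorem mem_conjClass_trans {a b c : F} (hc : c ∈ conjClass δ b) (hb : b ∈ conjClass δ a) :
    c ∈ conjClass δ a := by
  obtain ⟨β, hβ, h⟩ := mem_conjClass_iff.mp hc
  obtain ⟨γ, hγ, h'⟩ := mem_conjClass_iff.mp hb
  refine mem_conjClass_iff.mpr ⟨β * γ, mul_ne_zero hβ hγ, ?_⟩
  rw [← const_mul_const, ← mul_assoc, h, mul_assoc, h', ← mul_assoc, const_mul_const, map_mul]

theorem mem_conjClass_symm {a b : F} (hb : b ∈ conjClass δ a) : a ∈ conjClass δ b := by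
  obtain ⟨β, hβ, h⟩ := mem_conjClass_iff.mp hb
  have hβ' : σ β ≠ 0 := (map_ne_zero σ).mpr hβ
  refine mem_conjClass_iff.mpr ⟨β⁻¹, inv_ne_zero hβ, ?_⟩
  calc linear δ a * const δ β⁻¹
      = const δ (σ β)⁻¹ * (const δ (σ β) * linear δ a) * const δ β⁻¹ := by
        rw [← mul_assoc (const δ (σ β)⁻¹), const_mul_const, inv_mul_cancel₀ hβ', const_one, one_mul]
    _ = const δ (σ β⁻¹) * linear δ b := by
        rw [← h, mul_assoc, mul_assoc, const_mul_const, mul_inv_cancel₀ hβ, const_one, mul_one,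
          map_inv₀]

/-- Right multiplication by `u` pulls the left ideal of `x - c` back to that of a conjugate
`x - c'`, unless `u` is in it. -/
theorem exists_conj_mul_mem_iff {c : F} {u : SkewPoly δ} (hu : u ∉ Ideal.span {linear δ c}) :
    ∃ c' ∈ conjClass δ c, ∀ g, g * u ∈ Ideal.span {linear δ c} ↔ g ∈ Ideal.span {linear δ c'} := by
  obtain ⟨q, s, hus, hs⟩ := exists_remainder u (linear_ne_zero c)
  rw [degree_linear, degree_lt_iff] at hs
  obtain ⟨γ, rfl⟩ : ∃ γ, s = const δ γ := ⟨coeff s 0, by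
    ext k
    rcases Nat.eq_zero_or_pos k with rfl | hk
    · simp [const, coeff_monomial]
    · simp [const, coeff_monomial, hs k hk, hk.ne]⟩
  have hq : q * linear δ c ∈ Ideal.span {linear δ c} := Ideal.mem_span_singleton'.mpr ⟨q, rfl⟩
  have hγ : γ ≠ 0 := by
    rintro rfl
    rw [const_zero, add_zero] at hus
    exact hu (hus ▸ hq)
  have hγ' : σ γ ≠ 0 := (map_ne_zero σ).mpr hγ
  have hc' : (σ γ * c * γ⁻¹ + δ.toFun γ * γ⁻¹) ∈ conjClass δ c := ⟨γ, hγ, rfl⟩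
  refine ⟨_, hc', fun g => ?_⟩
  -- Modulo x - c, u is the nonzero constant γ; moving γ past a linear factor conjugates its root.
  have key : linear δ (σ γ * c * γ⁻¹ + δ.toFun γ * γ⁻¹) * const δ γ =
      const δ (σ γ) * linear δ c := by
    rw [linear_mul_const_eq_iff, ← add_mul, inv_mul_cancel_right₀ hγ]
  set c' := σ γ * c * γ⁻¹ + δ.toFun γ * γ⁻¹
  rw [hus, mul_add, Ideal.add_mem_iff_right _ (Ideal.mul_mem_left _ g hq),
    Ideal.mem_span_singleton', Ideal.mem_span_singleton']
  constructor
  · rintro ⟨h, hh⟩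
    refine ⟨h * const δ (σ γ)⁻¹, mul_right_cancel₀ (const_ne_zero hγ) ?_⟩
    rw [mul_assoc, key, mul_assoc, ← mul_assoc (const δ (σ γ)⁻¹), const_mul_const,
      inv_mul_cancel₀ hγ', const_one, one_mul, hh]
  · rintro ⟨h, rfl⟩
    exact ⟨h * const δ (σ γ), by rw [mul_assoc, mul_assoc, key]⟩

/-! ### Maximal left ideals -/

theorem codim_span_linear (c : F) : (Ideal.span {linear δ c} : Ideal (SkewPoly δ)).codim F = 1 :=
  codim_span (degree_linear c)

theorem isCoatom_span_linear (c : F) : IsCoatom (Ideal.span {linear δ c} : Ideal (SkewPoly δ)) := by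
  constructor
  · intro h
    have := codim_span_linear (δ := δ) c
    rw [h, Submodule.codim_top] at this
    exact zero_ne_one this
  · intro J hJ
    by_contra hne
    have := Submodule.finite_quotient_of_le F hJ.le
    refine hJ.ne (Submodule.eq_of_le_of_codim_le F hJ.le ?_)
    rw [codim_span_linear]
    exact Nat.one_le_iff_ne_zero.mpr (mt (Submodule.codim_eq_zero_iff F J).mp hne)

theorem exists_mul_add_eq_one {K : Ideal (SkewPoly δ)} (hK : IsCoatom K) {l : SkewPoly δ}
    (hl : l ∉ K) : ∃ u, ∃ k ∈ K, u * l + k = 1 := by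
  have htop : Ideal.span {l} ⊔ K = ⊤ := by
    refine hK.2 _ (lt_of_le_of_ne le_sup_right fun h => hl ?_)
    rw [h]
    exact Ideal.mem_sup_left (Ideal.mem_span_singleton_self l)
  obtain ⟨s, hs, k, hk, h⟩ := Submodule.mem_sup.mp ((Ideal.eq_top_iff_one _).mp htop)
  obtain ⟨u, rfl⟩ := Ideal.mem_span_singleton'.mp hs
  exact ⟨u, k, hk, h⟩

/-- The class of l generates the simple module R/K and is killed by x - c, so R/K is isomorphic to
R/R(x-c). The generator 1 of R/K then corresponds to the class of some u, and K is the annihilator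
of that class, again of the form R(x-c'). -/
theorem exists_eq_span_linear_of_mul_mem {K : Ideal (SkewPoly δ)} (hK : IsCoatom K)
    {l : SkewPoly δ} (hl : l ∉ K) {c : F} (hc : ∀ g ∈ Ideal.span {linear δ c}, g * l ∈ K) :
    ∃ c' ∈ conjClass δ c, K = Ideal.span {linear δ c'} := by
  obtain ⟨u, k, hk, huk⟩ := exists_mul_add_eq_one hK hl
  have hle : Ideal.span {linear δ c} ≤ Submodule.comap (LinearMap.toSpanSingleton _ _ l) K := hc
  have hne : Submodule.comap (LinearMap.toSpanSingleton _ _ l) K ≠ ⊤ := fun h => by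
    have h1 : (1 : SkewPoly δ) ∈ Submodule.comap (LinearMap.toSpanSingleton _ _ l) K :=
      h ▸ Submodule.mem_top
    exact hl (by simpa using h1)
  -- The annihilator of the class of l in R/K is proper and contains the maximal R(x-c), so the two
  -- agree.
  have heq := ((isCoatom_span_linear c).le_iff.mp hle).resolve_left hne
  have hiff : ∀ g, g * l ∈ K ↔ g ∈ Ideal.span {linear δ c} := fun g => by
    rw [← heq]; rfl
  have hu : u ∉ Ideal.span {linear δ c} := fun hu => by
    refine hK.1 ((Ideal.eq_top_iff_one _).mpr ?_)
    rw [← huk]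
    exact add_mem (hc u hu) hk
  obtain ⟨c', hc', h⟩ := exists_conj_mul_mem_iff hu
  refine ⟨c', hc', Ideal.ext fun g => ?_⟩
  rw [← h, ← hiff, mul_assoc]
  have hg : g = g * (u * l) + g * k := by rw [← mul_add, huk, mul_one]
  conv_lhs => rw [hg]
  exact Ideal.add_mem_iff_left _ (K.mul_mem_left g hk)

/-- Take the first partial product that lies in K: the preceding one is a nonzero vector of R/K
killed by a linear factor. -/
theorem exists_eq_span_linear_of_seqPoly_mem {r : ℕ} (b : Fin r → F) {K : Ideal (SkewPoly δ)}
    (hK : IsCoatom K) (h : seqPoly δ b ∈ K) : ∃ c, K = Ideal.span {linear δ c} := by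
  induction r with
  | zero =>
    rw [seqPoly_zero] at h
    exact absurd ((Ideal.eq_top_iff_one _).mpr h) hK.1
  | succ r ih =>
    by_cases h' : seqPoly δ (fun i : Fin r => b i.castSucc) ∈ K
    · exact ih _ h'
    · obtain ⟨c', -, hc'⟩ := exists_eq_span_linear_of_mul_mem hK h' (c := b (Fin.last r)) (by
        intro g hg
        obtain ⟨q, rfl⟩ := Ideal.mem_span_singleton'.mp hg
        rw [mul_assoc, ← seqPoly_succ]
        exact K.mul_mem_left q h)
      exact ⟨c', hc'⟩

/-! ### Multiplicity sequences -/

theorem IsMultSeq.seqPoly_mem_iff {r : ℕ} {b : Fin r → F} (hb : IsMultSeq δ b) (hr : 0 < r)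
    {c : F} : seqPoly δ b ∈ Ideal.span {linear δ c} ↔ c = b ⟨0, hr⟩ := by
  obtain ⟨h, hs⟩ := hb
  rw [← eval_eq_zero_iff_mem (linear_ne_zero c)]
  exact Set.ext_iff.mp hs c

theorem isMultSeq_of_forall {r : ℕ} {b : Fin r → F} (hr : 0 < r)
    (h : ∀ c, seqPoly δ b ∈ Ideal.span {linear δ c} ↔ c = b ⟨0, hr⟩) : IsMultSeq δ b :=
  ⟨hr, Set.ext fun c => (eval_eq_zero_iff_mem (linear_ne_zero c)).trans (h c)⟩

theorem seqPoly_mem_span_linear_head {r : ℕ} (b : Fin r → F) (hr : 0 < r) :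
    seqPoly δ b ∈ Ideal.span {linear δ (b ⟨0, hr⟩)} := by
  induction r with
  | zero => exact absurd hr (lt_irrefl 0)
  | succ r ih =>
    rw [seqPoly_succ]
    rcases Nat.eq_zero_or_pos r with rfl | hr'
    · rw [seqPoly_zero, mul_one]
      exact Ideal.mem_span_singleton_self _
    · exact Ideal.mul_mem_left _ _ (ih (fun i : Fin r => b i.castSucc) hr')

/-- Zeros of a right factor are zeros of the product, and the head is always a zero. -/
theorem IsMultSeq.castSucc {r : ℕ} {b : Fin (r + 1) → F} (hb : IsMultSeq δ b) (hr : 0 < r) :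
    IsMultSeq δ (fun i : Fin r => b i.castSucc) := by
  refine isMultSeq_of_forall hr fun c => ⟨fun h => ?_, ?_⟩
  · refine (hb.seqPoly_mem_iff r.succ_pos).mp ?_
    rw [seqPoly_succ]
    exact Ideal.mul_mem_left _ _ h
  · intro hc
    rw [hc]
    exact seqPoly_mem_span_linear_head (fun i : Fin r => b i.castSucc) hr

theorem isMultSeq_const (c : F) : IsMultSeq δ (fun _ : Fin 1 => c) := by
  refine isMultSeq_of_forall one_pos fun d => ?_
  rw [seqPoly_succ, seqPoly_zero, mul_one]
  constructor
  · intro h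
    have h2 : linear δ c - linear δ d ∈ Ideal.span {linear δ d} :=
      sub_mem h (Ideal.mem_span_singleton_self _)
    by_contra hne
    have h3 : linear δ c - linear δ d = const δ (d - c) := by
      ext k
      simp only [linear, coeff_sub, const, coeff_monomial]
      split_ifs <;> simp
    rw [h3] at h2
    have h4 := Ideal.mul_mem_left _ (const δ (d - c)⁻¹) h2
    rw [const_mul_const, inv_mul_cancel₀ (sub_ne_zero.mpr hne), const_one] at h4
    exact (isCoatom_span_linear d).1 ((Ideal.eq_top_iff_one _).mpr h4)
  · rintro rfl
    exact Ideal.mem_span_singleton_self _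

/-- Uniqueness of the zero, a condition on elements of F, becomes locality of R/RP_b, the form used
from here on. -/
theorem IsMultSeq.eq_of_isCoatom {r : ℕ} {b : Fin r → F} (hb : IsMultSeq δ b) (hr : 0 < r)
    {K : Ideal (SkewPoly δ)} (hK : IsCoatom K) (h : seqPoly δ b ∈ K) :
    K = Ideal.span {linear δ (b ⟨0, hr⟩)} := by
  obtain ⟨c, rfl⟩ := exists_eq_span_linear_of_seqPoly_mem b hK h
  rw [(hb.seqPoly_mem_iff hr).mp h]

end SkewPoly

namespace SkewPoly

variable {F : Type*} [DivisionRing F] {σ : F →+* F} {δ : SkewDerivation σ}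

/-! ### The minimal skew polynomial of a conjugacy class -/

/-- The minimal skew polynomial of the conjugacy class of `a`. -/
noncomputable abbrev classPoly (δ : SkewDerivation σ) (a : F) : SkewPoly δ :=
  minPoly (points δ (conjClass δ a))

theorem points_ne_zero (S : Set F) : ∀ p ∈ points δ S, p ≠ 0 := by
  rintro _ ⟨c, -, rfl⟩
  exact linear_ne_zero c

theorem mem_vanishing_points_iff {S : Set F} {g : SkewPoly δ} :
    g ∈ vanishing (points δ S) ↔ ∀ c ∈ S, g ∈ Ideal.span {linear δ c} := by
  rw [mem_vanishing_iff (points_ne_zero S), points, Set.forall_mem_image]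

theorem linear_mem_span_linear_iff {c d : F} :
    linear δ c ∈ Ideal.span {linear δ d} ↔ d = c := by
  have := (isMultSeq_const (δ := δ) c).seqPoly_mem_iff one_pos (c := d)
  rwa [seqPoly_succ, seqPoly_zero, mul_one] at this

theorem span_linear_inj {c d : F}
    (h : (Ideal.span {linear δ c} : Ideal (SkewPoly δ)) = Ideal.span {linear δ d}) : d = c :=
  linear_mem_span_linear_iff.mp (h ▸ Ideal.mem_span_singleton_self (linear δ c))

section

variable {a : F} (ha : IsAlg (points δ (conjClass δ a)))

include ha

theorem mem_span_classPoly_iff {g : SkewPoly δ} :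
    g ∈ Ideal.span {classPoly δ a} ↔ ∀ c ∈ conjClass δ a, g ∈ Ideal.span {linear δ c} := by
  rw [← mem_vanishing_iff_mem_span_minPoly (points_ne_zero _) ha, mem_vanishing_points_iff]

theorem isMonic_classPoly : IsMonic (classPoly δ a) :=
  (isMinimal_minPoly (points_ne_zero _) ha).2.1

theorem classPoly_mem_span_linear {c : F} (hc : c ∈ conjClass δ a) :
    classPoly δ a ∈ Ideal.span {linear δ c} :=
  (mem_span_classPoly_iff ha).mp (Ideal.mem_span_singleton_self _) c hc

/-- Right multiplication by h permits testing g at a conjugate point instead, and the class is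
stable under conjugation; so this left ideal is two-sided. -/
theorem mul_mem_span_classPoly {g : SkewPoly δ} (hg : g ∈ Ideal.span {classPoly δ a})
    (h : SkewPoly δ) : g * h ∈ Ideal.span {classPoly δ a} := by
  rw [mem_span_classPoly_iff ha] at hg ⊢
  intro c hc
  by_cases hh : h ∈ Ideal.span {linear δ c}
  · exact Ideal.mul_mem_left _ g hh
  · obtain ⟨c', hc', hiff⟩ := exists_conj_mul_mem_iff hh
    exact (hiff g).mpr (hg c' (mem_conjClass_trans hc' hc))

theorem exists_classPoly_mul_eq (h : SkewPoly δ) : ∃ h', classPoly δ a * h = h' * classPoly δ a := by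
  obtain ⟨q, hq⟩ := Ideal.mem_span_singleton'.mp
    (mul_mem_span_classPoly ha (Ideal.mem_span_singleton_self _) h)
  exact ⟨q, hq.symm⟩

theorem exists_classPoly_pow_mul_eq (n : ℕ) (h : SkewPoly δ) :
    ∃ h', classPoly δ a ^ n * h = h' * classPoly δ a ^ n := by
  induction n generalizing h with
  | zero => exact ⟨h, by simp⟩
  | succ n ih =>
    obtain ⟨h₁, e₁⟩ := exists_classPoly_mul_eq ha h
    obtain ⟨h₂, e₂⟩ := ih h₁
    exact ⟨h₂, by rw [pow_succ, mul_assoc, e₁, ← mul_assoc, e₂, mul_assoc]⟩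

/-- Normality stands in for primality: if f^n is invertible modulo K, say u f^n + k = 1, then f = f
u f^n + f k, and f u f^n = u' f^(n+1). -/
theorem classPoly_mem_of_pow_mem {K : Ideal (SkewPoly δ)} (hK : IsCoatom K) {n : ℕ}
    (h : classPoly δ a ^ n ∈ K) : classPoly δ a ∈ K := by
  induction n with
  | zero =>
    rw [pow_zero] at h
    exact absurd ((Ideal.eq_top_iff_one _).mpr h) hK.1
  | succ n ih =>
    by_cases hn : classPoly δ a ^ n ∈ K
    · exact ih hn
    · obtain ⟨u, k, hk, huk⟩ := exists_mul_add_eq_one hK hn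
      obtain ⟨u', hu'⟩ := exists_classPoly_mul_eq ha u
      rw [← mul_one (classPoly δ a), ← huk, mul_add, ← mul_assoc, hu', mul_assoc, ← pow_succ']
      exact add_mem (K.mul_mem_left _ h) (K.mul_mem_left _ hk)

/-- Every point of an algebraic conjugacy class belongs to a P-basis of it. -/
theorem exists_finset_basis {c₀ : F} (hc₀ : c₀ ∈ conjClass δ a) {m : ℕ}
    (hm : degree (classPoly δ a) = m) :
    ∃ S : Finset F, c₀ ∈ S ∧ (∀ c ∈ S, c ∈ conjClass δ a) ∧ S.card = m ∧
      (⨅ c ∈ S, Ideal.span {linear δ c}) = Ideal.span {classPoly δ a} := by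
  classical
  have hfin := finite_quotient_span (isMonic_classPoly ha).ne_zero
  have hcodim := codim_span hm
  have hle : ∀ S : Finset F, (∀ c ∈ S, c ∈ conjClass δ a) →
      Ideal.span {classPoly δ a} ≤ ⨅ c ∈ S, Ideal.span {linear δ c} := fun S hS =>
    le_iInf₂ fun c hc => (Ideal.span_singleton_le_iff_mem _).mpr
      (classPoly_mem_span_linear ha (hS c hc))
  have hstep : ∀ S : Finset F, (∀ c ∈ S, c ∈ conjClass δ a) →
      (⨅ c ∈ S, Ideal.span {linear δ c} : Ideal (SkewPoly δ)).codim F = S.card → ∀ c,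
      c ∈ conjClass δ a → ¬ (⨅ c ∈ S, Ideal.span {linear δ c}) ≤ Ideal.span {linear δ c} →
      (⨅ d ∈ insert c S, Ideal.span {linear δ d} : Ideal (SkewPoly δ)).codim F
        = (insert c S).card := by
    intro S hS hd c hc hnle
    have hcS : c ∉ S := fun hcS => hnle (iInf₂_le c hcS)
    have := Submodule.finite_quotient_of_le F (hle S hS)
    rw [Finset.iInf_insert, Finset.card_insert_of_notMem hcS,
      (Submodule.codim_inf_eq_add_iff F _ _).mpr, codim_span_linear, hd, add_comm]
    refine (isCoatom_span_linear c).2 _ (lt_of_le_of_ne le_sup_left fun h => hnle ?_)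
    rw [h]
    exact le_sup_right
  -- Start from c₀ and keep adding points of the class at which the current intersection does not
  -- vanish; each raises the codimension by one. Were this never to stop at a basis, m + 1 points
  -- would give codimension m + 1, above the bound m.
  by_contra hcon
  have hall : ∀ k : ℕ, ∃ S : Finset F, c₀ ∈ S ∧ (∀ c ∈ S, c ∈ conjClass δ a) ∧ S.card = k + 1 ∧
      (⨅ c ∈ S, Ideal.span {linear δ c} : Ideal (SkewPoly δ)).codim F = S.card := by
    intro k
    induction k with
    | zero =>
      refine ⟨{c₀}, by simp, by simpa using hc₀, by simp, ?_⟩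
      rw [Finset.iInf_singleton, codim_span_linear, Finset.card_singleton]
    | succ k ih =>
      obtain ⟨S, h₀, hS, hk, hd⟩ := ih
      by_cases hex : ∃ c ∈ conjClass δ a,
          ¬ (⨅ c ∈ S, Ideal.span {linear δ c}) ≤ Ideal.span {linear δ c}
      · obtain ⟨c, hc, hnle⟩ := hex
        refine ⟨insert c S, Finset.mem_insert_of_mem h₀, ?_, ?_, hstep S hS hd c hc hnle⟩
        · intro d hd
          rcases Finset.mem_insert.mp hd with rfl | h
          exacts [hc, hS d h]
        · rw [Finset.card_insert_of_notMem fun hcS => hnle (iInf₂_le c hcS), hk]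
      · push Not at hex
        have heq : (⨅ c ∈ S, Ideal.span {linear δ c}) = Ideal.span {classPoly δ a} :=
          le_antisymm (fun g hg => (mem_span_classPoly_iff ha).mpr fun c hc => hex c hc hg)
            (hle S hS)
        refine absurd ⟨S, h₀, hS, ?_, heq⟩ hcon
        rw [← hd, heq, hcodim]
  obtain ⟨S, -, hS, hk, hd⟩ := hall m
  have := Submodule.codim_anti F (hle S hS)
  rw [hcodim, hd, hk] at this
  omega

/-- R/Rf embeds in a finite product of the modules R/R(x-c), so its simple quotients are isomorphic
to one of them. The induction peels off points until the intersection of the remaining R(x-c) no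
longer lies in K. -/
theorem exists_conj_of_classPoly_mem {K : Ideal (SkewPoly δ)} (hK : IsCoatom K)
    (h : classPoly δ a ∈ K) : ∃ c ∈ conjClass δ a, K = Ideal.span {linear δ c} := by
  classical
  have key : ∀ T : Finset F, (∀ c ∈ T, c ∈ conjClass δ a) →
      (∀ g, (∀ c ∈ T, g ∈ Ideal.span {linear δ c}) → g ∈ K) →
      ∃ c ∈ conjClass δ a, K = Ideal.span {linear δ c} := by
    intro T
    induction T using Finset.induction_on with
    | empty =>
      intro _ h'
      exact absurd ((Ideal.eq_top_iff_one _).mpr (h' 1 (by simp))) hK.1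
    | insert j T _ ih =>
      intro hT h'
      by_cases hTK : ∀ g, (∀ c ∈ T, g ∈ Ideal.span {linear δ c}) → g ∈ K
      · exact ih (fun c hc => hT c (Finset.mem_insert_of_mem hc)) hTK
      · push Not at hTK
        obtain ⟨l, hlT, hlK⟩ := hTK
        have hlj : l ∉ Ideal.span {linear δ j} := fun hlj => hlK (h' l fun c hc => by
          rcases Finset.mem_insert.mp hc with rfl | hc
          exacts [hlj, hlT c hc])
        obtain ⟨c', hc', hiff⟩ := exists_conj_mul_mem_iff hlj
        obtain ⟨c'', hc'', rfl⟩ := exists_eq_span_linear_of_mul_mem hK hlK (c := c') (by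
          intro g hg
          refine h' _ fun c hc => ?_
          rcases Finset.mem_insert.mp hc with rfl | hc
          exacts [(hiff g).mpr hg, Ideal.mul_mem_left _ _ (hlT c hc)])
        exact ⟨c'', mem_conjClass_trans hc'' (mem_conjClass_trans hc'
          (hT j (Finset.mem_insert_self j T))), rfl⟩
  obtain ⟨m, hm, -⟩ := isMonic_classPoly ha
  obtain ⟨S, -, hS, -, heq⟩ := exists_finset_basis ha (self_mem_conjClass a) hm
  refine key S hS fun g hg => ?_
  have hg' : g ∈ ⨅ c ∈ S, Ideal.span {linear δ c} := by simpa [Submodule.mem_iInf] using hg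
  rw [heq] at hg'
  exact (Ideal.span_singleton_le_iff_mem K).mpr h hg'

theorem mem_conjClass_of_pow_mem {n : ℕ} {d : F}
    (h : classPoly δ a ^ n ∈ Ideal.span {linear δ d}) : d ∈ conjClass δ a := by
  obtain ⟨c, hc, hcd⟩ := exists_conj_of_classPoly_mem ha (isCoatom_span_linear d)
    (classPoly_mem_of_pow_mem ha (isCoatom_span_linear d) h)
  rwa [span_linear_inj hcd] at hc

end

end SkewPoly

/-! ### Powers of class polynomials and multiplicity sequences -/

namespace SkewPoly

variable {F : Type*} [DivisionRing F] {σ : F →+* F} {δ : SkewDerivation σ}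

/-! ### Multiplicity sequences divide powers of the minimal skew polynomial of a class -/

theorem finite_quotient_span_classPoly_pow {a : F} (ha : IsAlg (points δ (conjClass δ a))) (r : ℕ) :
    Module.Finite F (SkewPoly δ ⧸ Ideal.span {classPoly δ a ^ r}) :=
  finite_quotient_span (isMonic_pow (isMonic_classPoly ha) r).ne_zero

/-- A maximal left ideal over both would be R(x-d) with d in both classes. -/
theorem span_classPoly_pow_sup_span_classPoly {a c : F} (ha : IsAlg (points δ (conjClass δ a)))
    (hc : IsAlg (points δ (conjClass δ c))) (hac : c ∉ conjClass δ a) (r : ℕ) :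
    Ideal.span {classPoly δ a ^ r} ⊔ Ideal.span {classPoly δ c} = ⊤ := by
  refine (eq_top_or_exists_le_coatom _).resolve_right ?_
  rintro ⟨K, hK, hle⟩
  have h₁ : classPoly δ a ^ r ∈ K := hle (Ideal.mem_sup_left (Ideal.mem_span_singleton_self _))
  have h₂ : classPoly δ c ∈ K := hle (Ideal.mem_sup_right (Ideal.mem_span_singleton_self _))
  obtain ⟨d, hd, rfl⟩ := exists_conj_of_classPoly_mem hc hK h₂
  exact hac (mem_conjClass_trans (mem_conjClass_symm hd) (mem_conjClass_of_pow_mem ha h₁))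

/-- By normality both products lie in the intersection of the two comaximal ideals, and the degree
of f_c f_a^r, with f_c the minimal polynomial of C(c), is the codimension of that intersection, so
it generates it. -/
theorem classPoly_pow_mul_mem_span {a c : F} (ha : IsAlg (points δ (conjClass δ a)))
    (hc : IsAlg (points δ (conjClass δ c))) (hac : c ∉ conjClass δ a) (r : ℕ) :
    classPoly δ a ^ r * classPoly δ c ∈ Ideal.span {classPoly δ c * classPoly δ a ^ r} := by
  obtain ⟨m, hm, -⟩ := isMonic_classPoly ha
  obtain ⟨n, hn, -⟩ := isMonic_classPoly hc
  have := finite_quotient_span_classPoly_pow ha r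
  have := finite_quotient_span (isMonic_classPoly hc).ne_zero
  have hd := degree_mul hn (degree_pow hm r)
  have := finite_quotient_span (ne_zero_of_degree_eq hd)
  have heq : Ideal.span {classPoly δ c * classPoly δ a ^ r} =
      Ideal.span {classPoly δ a ^ r} ⊓ Ideal.span {classPoly δ c} := by
    refine Submodule.eq_of_le_of_codim_le F ?_ ?_
    · rw [Ideal.span_singleton_le_iff_mem]
      obtain ⟨h, e⟩ := exists_classPoly_mul_eq hc (classPoly δ a ^ r)
      exact ⟨Ideal.mem_span_singleton'.mpr ⟨_, rfl⟩, Ideal.mem_span_singleton'.mpr ⟨h, e.symm⟩⟩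
    · rw [(Submodule.codim_inf_eq_add_iff F _ _).mpr
        (span_classPoly_pow_sup_span_classPoly ha hc hac r), codim_span hd, codim_span hn,
        codim_span (degree_pow hm r), add_comm]
  rw [heq]
  obtain ⟨h, e⟩ := exists_classPoly_pow_mul_eq ha r (classPoly δ c)
  exact ⟨Ideal.mem_span_singleton'.mpr ⟨h, e.symm⟩, Ideal.mem_span_singleton'.mpr ⟨_, rfl⟩⟩

theorem linear_mul_dvd_classPoly_pow_succ {a c : F} (ha : IsAlg (points δ (conjClass δ a)))
    (hc : c ∈ conjClass δ a) {p : SkewPoly δ} {r : ℕ} (hp : classPoly δ a ^ r ∈ Ideal.span {p}) :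
    classPoly δ a ^ (r + 1) ∈ Ideal.span {linear δ c * p} := by
  obtain ⟨h, e⟩ := Ideal.mem_span_singleton'.mp hp
  obtain ⟨h', e'⟩ := exists_classPoly_mul_eq ha h
  obtain ⟨q, hq⟩ := Ideal.mem_span_singleton'.mp (classPoly_mem_span_linear ha hc)
  refine Ideal.mem_span_singleton'.mpr ⟨h' * q, ?_⟩
  rw [pow_succ', ← e, ← mul_assoc (classPoly δ a), e', ← mul_assoc, mul_assoc h', hq]

/-- The last term of a multiplicity sequence is conjugate to the first one. -/
theorem IsMultSeq.last_mem_conjClass (halg : ∀ c : F, IsAlg (points δ (conjClass δ c))) {a : F}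
    {r : ℕ} {b : Fin (r + 1) → F} (hb : IsMultSeq δ b) (hba : b 0 ∈ conjClass δ a)
    (ih : classPoly δ a ^ r ∈ Ideal.span {seqPoly δ (fun i : Fin r => b i.castSucc)}) :
    b (Fin.last r) ∈ conjClass δ a := by
  by_contra hac
  set P := seqPoly δ (fun i : Fin r => b i.castSucc) with hP
  have hbP : seqPoly δ b = linear δ (b (Fin.last r)) * P := seqPoly_succ b
  set c := b (Fin.last r)
  have ha := halg a
  have hc := halg c
  set J : Ideal (SkewPoly δ) := Ideal.span {seqPoly δ b} with hJ
  have hJ0 : J ≤ Ideal.span {linear δ (b 0)} :=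
    (Ideal.span_singleton_le_iff_mem _).mpr (seqPoly_mem_span_linear_head b r.succ_pos)
  obtain ⟨h, e⟩ := Ideal.mem_span_singleton'.mp ih
  have hca : classPoly δ c * classPoly δ a ^ r ∈ J := by
    obtain ⟨h', e'⟩ := exists_classPoly_mul_eq hc h
    obtain ⟨q, hq⟩ := Ideal.mem_span_singleton'.mp
      (classPoly_mem_span_linear hc (self_mem_conjClass c))
    refine Ideal.mem_span_singleton'.mpr ⟨h' * q, ?_⟩
    rw [hbP, ← e, ← mul_assoc (classPoly δ c), e', ← mul_assoc, mul_assoc h', hq]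
  have hac' : classPoly δ a ^ r * classPoly δ c ∈ J :=
    (Ideal.span_singleton_le_iff_mem J).mpr hca (classPoly_pow_mul_mem_span ha hc hac r)
  -- With f_c the minimal polynomial of C(c): if 1 = x f_a^r + j, multiplying by f_c on the left
  -- puts f_c in J, so b_1 would be conjugate to c.
  have hA : Ideal.span {classPoly δ a ^ r} ⊔ J ≠ ⊤ := by
    intro htop
    obtain ⟨s, hs, j, hj, hsj⟩ := Submodule.mem_sup.mp ((Ideal.eq_top_iff_one _).mp htop)
    obtain ⟨x, rfl⟩ := Ideal.mem_span_singleton'.mp hs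
    obtain ⟨x', hx'⟩ := exists_classPoly_mul_eq hc x
    have hcJ : classPoly δ c ∈ J := by
      rw [← mul_one (classPoly δ c), ← hsj, mul_add, ← mul_assoc, hx', mul_assoc]
      exact add_mem (J.mul_mem_left _ hca) (J.mul_mem_left _ hj)
    have hbc : b 0 ∈ conjClass δ c :=
      mem_conjClass_of_pow_mem hc (n := 1) (by rw [pow_one]; exact hJ0 hcJ)
    exact hac (mem_conjClass_trans (mem_conjClass_symm hbc) hba)
  -- If 1 = x f_c + j, then f_a^r lies in J = R(x-c)P. So does f_a^r P = y f_a^r, and cancelling P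
  -- makes c a zero of f_a^r.
  have hB : Ideal.span {classPoly δ c} ⊔ J ≠ ⊤ := by
    intro htop
    obtain ⟨s, hs, j, hj, hsj⟩ := Submodule.mem_sup.mp ((Ideal.eq_top_iff_one _).mp htop)
    obtain ⟨x, rfl⟩ := Ideal.mem_span_singleton'.mp hs
    obtain ⟨x', hx'⟩ := exists_classPoly_pow_mul_eq ha r x
    have haJ : classPoly δ a ^ r ∈ J := by
      rw [← mul_one (classPoly δ a ^ r), ← hsj, mul_add, ← mul_assoc, hx', mul_assoc]
      exact add_mem (J.mul_mem_left _ hac') (J.mul_mem_left _ hj)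
    obtain ⟨y, hy⟩ := exists_classPoly_pow_mul_eq ha r P
    obtain ⟨q, hq⟩ := Ideal.mem_span_singleton'.mp (J.mul_mem_left y haJ)
    rw [← hy, hbP, ← mul_assoc] at hq
    have hq' := mul_right_cancel₀ (seqPoly_ne_zero _) hq
    exact hac (mem_conjClass_of_pow_mem ha (Ideal.mem_span_singleton'.mpr ⟨q, hq'⟩))
  -- Locality: any left ideal not comaximal with J lies in R(x-b_1). Two comaximal ideals cannot
  -- both do so.
  have hloc : ∀ I : Ideal (SkewPoly δ), I ⊔ J ≠ ⊤ → I ≤ Ideal.span {linear δ (b 0)} := by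
    intro I hI
    obtain ⟨K, hK, hle⟩ := (eq_top_or_exists_le_coatom (I ⊔ J)).resolve_left hI
    have hKb := hb.eq_of_isCoatom r.succ_pos hK
      (hle (Ideal.mem_sup_right (Ideal.mem_span_singleton_self _)))
    exact (le_sup_left.trans hle).trans hKb.le
  have htop := span_classPoly_pow_sup_span_classPoly ha hc hac r
  exact (isCoatom_span_linear (b 0)).1 (top_le_iff.mp (htop ▸ sup_le (hloc _ hA) (hloc _ hB)))

theorem IsMultSeq.classPoly_pow_mem (halg : ∀ c : F, IsAlg (points δ (conjClass δ c))) {a : F}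
    {r : ℕ} {b : Fin r → F} (hb : IsMultSeq δ b) (hr : 0 < r) (hba : b ⟨0, hr⟩ ∈ conjClass δ a) :
    classPoly δ a ^ r ∈ Ideal.span {seqPoly δ b} := by
  induction r with
  | zero => exact absurd hr (lt_irrefl 0)
  | succ r ih =>
    have hpre : classPoly δ a ^ r ∈ Ideal.span {seqPoly δ (fun i : Fin r => b i.castSucc)} := by
      rcases Nat.eq_zero_or_pos r with rfl | hr'
      · rw [seqPoly_zero, pow_zero]
        exact Ideal.mem_span_singleton_self 1
      · exact ih (hb.castSucc hr') hr' hba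
    rw [seqPoly_succ]
    exact linear_mul_dvd_classPoly_pow_succ (halg a) (hb.last_mem_conjClass halg hba hpre) hpre

/-! ### Least common multiples of multiplicity sequences -/

theorem codim_iInf_span_seqPoly {ι : Type*} [Fintype ι] {p : ι → F}
    (hp : (⨅ i, Ideal.span {linear δ (p i)} : Ideal (SkewPoly δ)).codim F = Fintype.card ι)
    {l : ι → ℕ} (hl : ∀ i, 0 < l i) (s : ∀ i, Fin (l i) → F) (hs : ∀ i, IsMultSeq δ (s i))
    (hsp : ∀ i, s i ⟨0, hl i⟩ = p i) :
    (⨅ i, Ideal.span {seqPoly δ (s i)} : Ideal (SkewPoly δ)).codim F = ∑ i, l i := by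
  have hsum : ∑ i, l i =
      ∑ i, (Ideal.span {seqPoly δ (s i)} : Ideal (SkewPoly δ)).codim F :=
    Finset.sum_congr rfl fun i _ => (codim_span (degree_seqPoly (s i))).symm
  rw [hsum, Submodule.codim_iInf_eq_sum_iff]
  refine Submodule.surjective_pi_mkQ_of_isCoatom (N' := fun i => Ideal.span {linear δ (p i)}) ?_ ?_
  · intro i L hL hle
    rw [← hsp i]
    exact ((hs i).eq_of_isCoatom (hl i) hL (hle (Ideal.mem_span_singleton_self _))).ge
  · rw [← Submodule.codim_iInf_eq_sum_iff F, hp]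
    simp [codim_span_linear]

/-- A multiplicity sequence in an algebraic conjugacy class can be continued. -/
theorem IsMultSeq.exists_snoc (halg : ∀ c : F, IsAlg (points δ (conjClass δ c))) {a : F}
    {r : ℕ} {b : Fin r → F} (hb : IsMultSeq δ b) (hr : 0 < r) (hba : b ⟨0, hr⟩ ∈ conjClass δ a) :
    ∃ c : F, IsMultSeq δ (Fin.snoc b c : Fin (r + 1) → F) := by
  by_contra! hcon
  have ha := halg a
  obtain ⟨m, hm, -⟩ := isMonic_classPoly ha
  have := finite_quotient_span (isMonic_classPoly ha).ne_zero
  have hseq : ∀ c, seqPoly δ (Fin.snoc b c : Fin (r + 1) → F) = linear δ c * seqPoly δ b := by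
    intro c
    rw [seqPoly_succ]
    simp
  have hdeg := degree_mul hm (degree_seqPoly b (δ := δ))
  have := finite_quotient_span (ne_zero_of_degree_eq hdeg)
  -- If no c continues b, then for each c in C(a) the product (x-c)P_b has a second zero d in C(a),
  -- and R(x-c)P_b is the intersection of RP_b and R(x-d). So h P_b in Rf forces h in R(x-c) for all
  -- these c, that is, h in Rf.
  have hle : Ideal.span {classPoly δ a} ⊓ Ideal.span {seqPoly δ b} ≤
      Ideal.span {classPoly δ a * seqPoly δ b} := by
    rintro g ⟨hga, hgb⟩
    obtain ⟨h, rfl⟩ := Ideal.mem_span_singleton'.mp hgb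
    suffices hh : h ∈ Ideal.span {classPoly δ a} by
      obtain ⟨q, rfl⟩ := Ideal.mem_span_singleton'.mp hh
      exact Ideal.mem_span_singleton'.mpr ⟨q, (mul_assoc _ _ _).symm⟩
    rw [mem_span_classPoly_iff ha]
    intro c hc
    obtain ⟨d, hd, hdb⟩ : ∃ d, linear δ c * seqPoly δ b ∈ Ideal.span {linear δ d} ∧
        d ≠ b ⟨0, hr⟩ := by
      by_contra! hno
      refine hcon c (isMultSeq_of_forall r.succ_pos fun d => ?_)
      have h0 : (Fin.snoc b c : Fin (r + 1) → F) ⟨0, r.succ_pos⟩ = b ⟨0, hr⟩ := by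
        exact Fin.snoc_castSucc (α := fun _ => F) c b ⟨0, hr⟩
      rw [hseq, h0]
      refine ⟨hno d, ?_⟩
      rintro rfl
      exact Ideal.mul_mem_left _ _ (seqPoly_mem_span_linear_head b hr)
    have hda : d ∈ conjClass δ a := mem_conjClass_of_pow_mem ha
      ((Ideal.span_singleton_le_iff_mem _).mpr hd
        (linear_mul_dvd_classPoly_pow_succ ha hc (hb.classPoly_pow_mem halg hr hba)))
    have hnb : seqPoly δ b ∉ Ideal.span {linear δ d} := fun h' =>
      hdb ((hb.seqPoly_mem_iff hr).mp h')
    have hcdeg := degree_mul (degree_linear c (δ := δ)) (degree_seqPoly b (δ := δ))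
    have := finite_quotient_span (ne_zero_of_degree_eq hcdeg)
    have htop : Ideal.span {seqPoly δ b} ⊔ Ideal.span {linear δ d} = ⊤ := by
      refine (isCoatom_span_linear d).2 _ (lt_of_le_of_ne le_sup_right fun h' => hnb ?_)
      rw [h']
      exact Ideal.mem_sup_left (Ideal.mem_span_singleton_self _)
    have heq : Ideal.span {linear δ c * seqPoly δ b} =
        Ideal.span {seqPoly δ b} ⊓ Ideal.span {linear δ d} := by
      refine Submodule.eq_of_le_of_codim_le F ?_ ?_
      · rw [Ideal.span_singleton_le_iff_mem]
        exact ⟨Ideal.mem_span_singleton'.mpr ⟨_, rfl⟩, hd⟩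
      · rw [(Submodule.codim_inf_eq_add_iff F _ _).mpr htop, codim_span hcdeg,
          codim_span (degree_seqPoly b), codim_span_linear, add_comm]
    have hg : h * seqPoly δ b ∈ Ideal.span {linear δ c * seqPoly δ b} := by
      rw [heq]
      exact ⟨hgb, (mem_span_classPoly_iff ha).mp hga d hda⟩
    obtain ⟨q, hq⟩ := Ideal.mem_span_singleton'.mp hg
    rw [← mul_assoc] at hq
    exact Ideal.mem_span_singleton'.mpr ⟨q, mul_right_cancel₀ (seqPoly_ne_zero b) hq⟩
  have hfin : Module.Finite F
      (SkewPoly δ ⧸ (Ideal.span {classPoly δ a} ⊓ Ideal.span {seqPoly δ b} : Ideal (SkewPoly δ))) := by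
    refine finite_quotient_of_mem
      (isMonic_pow (isMonic_classPoly ha) r).ne_zero ⟨?_, hb.classPoly_pow_mem halg hr hba⟩
    -- Only for r ≥ 1 is f^r a multiple of f.
    obtain ⟨k, rfl⟩ : ∃ k, r = k + 1 := ⟨r - 1, by omega⟩
    exact Ideal.mem_span_singleton'.mpr ⟨_, (pow_succ _ _).symm⟩
  have h₁ := Submodule.codim_anti F hle
  have h₂ := Submodule.codim_inf_le F (Ideal.span {classPoly δ a} : Ideal (SkewPoly δ))
    (Ideal.span {seqPoly δ b})
  -- The inclusion gives the intersection codimension at least deg f + r, the maximum possible, so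
  -- Rf and RP_b would be comaximal; yet both lie in R(x-b_1).
  have htop := (Submodule.codim_inf_eq_add_iff F (Ideal.span {classPoly δ a} : Ideal (SkewPoly δ))
    (Ideal.span {seqPoly δ b})).mp (le_antisymm h₂ (by
      rw [codim_span hm, codim_span (degree_seqPoly b), ← codim_span hdeg]; exact h₁))
  refine (isCoatom_span_linear (δ := δ) (b ⟨0, hr⟩)).1 (top_le_iff.mp (htop ▸ sup_le ?_ ?_))
  · exact (Ideal.span_singleton_le_iff_mem _).mpr (classPoly_mem_span_linear ha hba)
  · exact (Ideal.span_singleton_le_iff_mem _).mpr (seqPoly_mem_span_linear_head b hr)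

theorem exists_isMultSeq (halg : ∀ c : F, IsAlg (points δ (conjClass δ c))) (c : F) {r : ℕ}
    (hr : 0 < r) : ∃ b : Fin r → F, IsMultSeq δ b ∧ b ⟨0, hr⟩ = c := by
  induction r with
  | zero => exact absurd hr (lt_irrefl 0)
  | succ r ih =>
    rcases Nat.eq_zero_or_pos r with rfl | hr'
    · exact ⟨fun _ => c, isMultSeq_const c, rfl⟩
    · obtain ⟨b, hb, hbc⟩ := ih hr'
      obtain ⟨d, hd⟩ := hb.exists_snoc halg hr' (self_mem_conjClass _)
      exact ⟨_, hd, (Fin.snoc_castSucc (α := fun _ => F) d b ⟨0, hr'⟩).trans hbc⟩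

section

variable {ι : Type*} [Fintype ι] {a : F} {p : ι → F}
  (hp : (⨅ i, Ideal.span {linear δ (p i)} : Ideal (SkewPoly δ)) = Ideal.span {classPoly δ a})
  (hm : degree (classPoly δ a) = (Fintype.card ι : ℕ))

include hp hm

theorem iInf_span_seqPoly_eq (halg : ∀ c : F, IsAlg (points δ (conjClass δ c))) {r : ℕ}
    (hr : 0 < r) (s : ι → Fin r → F) (hs : ∀ i, IsMultSeq δ (s i))
    (hsp : ∀ i, s i ⟨0, hr⟩ = p i) :
    (⨅ i, Ideal.span {seqPoly δ (s i)}) = Ideal.span {classPoly δ a ^ r} := by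
  have hpa : ∀ i, p i ∈ conjClass δ a := fun i => mem_conjClass_of_pow_mem (halg a) (n := 1) (by
    have : classPoly δ a ∈ ⨅ i, Ideal.span {linear δ (p i)} := by
      rw [hp]; exact Ideal.mem_span_singleton_self _
    rw [pow_one]
    exact (Submodule.mem_iInf _).mp this i)
  have := finite_quotient_span_classPoly_pow (halg a) r
  refine (Submodule.eq_of_le_of_codim_le F ?_ ?_).symm
  · exact le_iInf fun i => (Ideal.span_singleton_le_iff_mem _).mpr
      ((hs i).classPoly_pow_mem halg hr (by rw [hsp]; exact hpa i))
  · rw [codim_iInf_span_seqPoly (by rw [hp, codim_span hm]) (fun _ => hr) s hs hsp,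
      codim_span (degree_pow hm r)]
    simp [mul_comm]

theorem length_le_of_classPoly_pow_mem (halg : ∀ c : F, IsAlg (points δ (conjClass δ c))) {r : ℕ}
    (hr : 0 < r) {k : ℕ} (hk : 0 < k) {b : Fin k → F} (hb : IsMultSeq δ b) {i₀ : ι}
    (hb₀ : b ⟨0, hk⟩ = p i₀) (h : classPoly δ a ^ r ∈ Ideal.span {seqPoly δ b}) : k ≤ r := by
  by_contra! hlt
  have hpa : ∀ i, p i ∈ conjClass δ a := fun i => mem_conjClass_of_pow_mem (halg a) (n := 1) (by
    have : classPoly δ a ∈ ⨅ i, Ideal.span {linear δ (p i)} := by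
      rw [hp]; exact Ideal.mem_span_singleton_self _
    rw [pow_one]
    exact (Submodule.mem_iInf _).mp this i)
  -- Over each basis point a multiplicity sequence whose product divides f^r: b itself over p_{i₀},
  -- length r elsewhere. With k > r the lengths sum to more than deg f^r, although the codimension
  -- of the intersection is that sum.
  have hex : ∀ i, ∃ (l : ℕ) (hl : 0 < l) (t : Fin l → F), IsMultSeq δ t ∧ t ⟨0, hl⟩ = p i ∧
      classPoly δ a ^ r ∈ Ideal.span {seqPoly δ t} ∧ r ≤ l ∧ (i = i₀ → r < l) := by
    intro i
    by_cases hi : i = i₀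
    · subst hi
      exact ⟨k, hk, b, hb, hb₀, h, hlt.le, fun _ => hlt⟩
    · obtain ⟨t, ht, ht₀⟩ := exists_isMultSeq halg (p i) hr
      exact ⟨r, hr, t, ht, ht₀, ht.classPoly_pow_mem halg hr (by rw [ht₀]; exact hpa i), le_rfl,
        fun h' => absurd h' hi⟩
  choose l hl t ht ht₀ htm hrl hrl₀ using hex
  have hcod := codim_iInf_span_seqPoly (by rw [hp, codim_span hm]) hl t ht ht₀
  have := finite_quotient_span_classPoly_pow (halg a) r
  have hle : Ideal.span {classPoly δ a ^ r} ≤ ⨅ i, Ideal.span {seqPoly δ (t i)} :=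
    le_iInf fun i => (Ideal.span_singleton_le_iff_mem _).mpr (htm i)
  have h₁ := Submodule.codim_anti F hle
  rw [hcod, codim_span (degree_pow hm r)] at h₁
  have h₂ : ∑ _i : ι, r < ∑ i, l i :=
    Finset.sum_lt_sum (fun i _ => hrl i) ⟨i₀, Finset.mem_univ _, hrl₀ i₀ rfl⟩
  rw [Finset.sum_const, Finset.card_univ, smul_eq_mul, mul_comm] at h₂
  exact absurd h₂ (not_lt.mpr h₁)

end

/-! ### Conjugacy classes with multiplicities -/

theorem multUniv_ne_zero {p : SkewPoly δ} (hp : p ∈ multUniv δ) : p ≠ 0 := by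
  obtain ⟨r, b, -, rfl⟩ := hp
  exact seqPoly_ne_zero b

theorem multConjClass_subset_multUniv (r : ℕ) (a : F) : multConjClass δ r a ⊆ multUniv δ := by
  rintro _ ⟨i, hi, b, -, hb, -, rfl⟩
  exact ⟨i, b, hb, rfl⟩

section

variable (halg : ∀ c : F, IsAlg (points δ (conjClass δ c)))

include halg

theorem exists_indexed_basis {a c₀ : F} (hc₀ : c₀ ∈ conjClass δ a) :
    ∃ S : Finset F, c₀ ∈ S ∧ degree (classPoly δ a) = (Fintype.card S : ℕ) ∧
      (⨅ c : S, Ideal.span {linear δ (c : F)}) = Ideal.span {classPoly δ a} := by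
  obtain ⟨m, hm, -⟩ := isMonic_classPoly (halg a)
  obtain ⟨S, hS₀, -, hcard, hS⟩ := exists_finset_basis (halg a) hc₀ hm
  refine ⟨S, hS₀, by rw [hm, Fintype.card_coe, hcard], ?_⟩
  rw [← hS, iInf_subtype]

/-- C_r(a) is thereby the zero set of f^r in U_2, from which P-closedness follows. Conversely to
item 1, a divisor P_b of f^r has b_1 among the zeros of f^r, hence in C(a), and a P-basis through
b_1 bounds its length. -/
theorem mem_multConjClass_iff {a : F} {r : ℕ} (hr : 0 < r) {p : SkewPoly δ} :
    p ∈ multConjClass δ r a ↔ p ∈ multUniv δ ∧ classPoly δ a ^ r ∈ Ideal.span {p} := by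
  constructor
  · rintro ⟨i, hi, b, hir, hb, hba, rfl⟩
    refine ⟨⟨i, b, hb, rfl⟩, ?_⟩
    obtain ⟨k, rfl⟩ := Nat.exists_eq_add_of_le' hir
    rw [pow_add]
    exact Ideal.mul_mem_left _ _ (hb.classPoly_pow_mem halg hi hba)
  · rintro ⟨⟨k, b, hb, rfl⟩, h⟩
    have hk : 0 < k := hb.1
    have hba : b ⟨0, hk⟩ ∈ conjClass δ a := mem_conjClass_of_pow_mem (halg a)
      ((Ideal.span_singleton_le_iff_mem _).mpr (seqPoly_mem_span_linear_head b hk) h)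
    obtain ⟨S, hS₀, hcard, hS⟩ := exists_indexed_basis halg hba
    exact ⟨k, hk, b, length_le_of_classPoly_pow_mem hS hcard halg hr hk hb
      (i₀ := ⟨_, hS₀⟩) rfl h, hb, hba, rfl⟩

theorem mem_vanishing_multConjClass_iff {a : F} {r : ℕ} (hr : 0 < r) {g : SkewPoly δ} :
    g ∈ vanishing (multConjClass δ r a) ↔ g ∈ Ideal.span {classPoly δ a ^ r} := by
  rw [mem_vanishing_iff fun p hp => multUniv_ne_zero (multConjClass_subset_multUniv r a hp)]
  constructor
  · intro hg
    obtain ⟨S, -, hcard, hS⟩ := exists_indexed_basis halg (self_mem_conjClass (δ := δ) a)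
    choose s hs hs₀ using fun c : S => exists_isMultSeq halg (c : F) hr
    have hinf := iInf_span_seqPoly_eq hS hcard halg hr s hs hs₀
    rw [← hinf, Submodule.mem_iInf]
    refine fun c => hg _ ((mem_multConjClass_iff halg hr).mpr ⟨⟨r, s c, hs c, rfl⟩, ?_⟩)
    exact (Submodule.mem_iInf _).mp (hinf ▸ Ideal.mem_span_singleton_self _) c
  · intro hg p hp
    exact (Ideal.span_singleton_le_iff_mem _).mpr ((mem_multConjClass_iff halg hr).mp hp).2 hg

theorem pClosure_eq_multConjClass {a : F} {r : ℕ} (hr : 0 < r) {Ω : Set (SkewPoly δ)}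
    (hΩ : ∀ g, g ∈ vanishing Ω ↔ g ∈ Ideal.span {classPoly δ a ^ r}) :
    pClosure (multUniv δ) Ω = multConjClass δ r a := by
  ext p
  rw [mem_multConjClass_iff halg hr]
  refine and_congr_right fun hp => ?_
  constructor
  · intro h
    exact (eval_eq_zero_iff_mem (multUniv_ne_zero hp)).mp
      (h _ ((hΩ _).mpr (Ideal.mem_span_singleton_self _)))
  · intro h g hg
    exact (eval_eq_zero_iff_mem (multUniv_ne_zero hp)).mpr
      ((Ideal.span_singleton_le_iff_mem _).mpr h ((hΩ g).mp hg))

/-- Equal closures force equal vanishing ideals, so the basis and the class share their minimal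
polynomial; P-independence then reads its degree as the number of points. -/
theorem iInf_eq_of_isPBasis {a : F} {m : ℕ} {p : Fin m → F} (hinj : Function.Injective p)
    (hB : IsPBasis (linearUniv δ) (points δ (Set.range p)) (points δ (conjClass δ a))) :
    (⨅ i, Ideal.span {linear δ (p i)}) = Ideal.span {classPoly δ a} ∧
      degree (classPoly δ a) = (m : ℕ) := by
  classical
  obtain ⟨-, hBU, -, ⟨-, S, hS, hdeg⟩, hcl⟩ := hB
  have hsub : points δ (Set.range p) ⊆ points δ (conjClass δ a) := by
    rw [← hcl]
    exact fun q hq => ⟨hBU hq, fun g hg => hg q hq⟩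
  have hvan : vanishing (points δ (Set.range p)) = vanishing (points δ (conjClass δ a)) := by
    refine Set.Subset.antisymm (fun g hg q hq => ?_) fun g hg q hq => hg q (hsub hq)
    rw [← hcl] at hq
    exact hq.2 g hg
  have hmin : minPoly (points δ (Set.range p)) = classPoly δ a := by
    refine minPoly_eq_of_vanishing (points_ne_zero _) (isMonic_classPoly (halg a)) fun g => ?_
    rw [hvan]
    exact mem_vanishing_iff_mem_span_minPoly (points_ne_zero _) (halg a)
  constructor
  · ext g
    rw [← mem_vanishing_iff_mem_span_minPoly (points_ne_zero _) (halg a), ← hvan,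
      mem_vanishing_points_iff, Submodule.mem_iInf, Set.forall_mem_range]
  · have hSi : S = Finset.univ.image fun i => linear δ (p i) := by
      rw [← Finset.coe_inj, hS, points, ← Set.range_comp]
      simp [Function.comp_def]
    have hinj' : Function.Injective fun i => linear δ (p i) := fun i j hij =>
      hinj (span_linear_inj (by rw [show linear δ (p j) = linear δ (p i) from hij.symm]))
    rw [← hmin, hdeg, hSi, Finset.sum_image fun i _ j _ hij => hinj' hij]
    simp [degree_linear]

end

end SkewPoly

/-! ### The main theorem -/

theorem mainTheorem6 {F : Type*} [DivisionRing F] (σ : F →+* F) (δ : SkewDerivation σ)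
    (halg : ∀ c : F, SkewPoly.IsAlg (SkewPoly.points δ (SkewPoly.conjClass δ c)))
    (a : F) (r : ℕ) (hr : 0 < r) :
    -- item 1
    (∀ b : Fin r → F, SkewPoly.IsMultSeq δ b → b ⟨0, hr⟩ ∈ SkewPoly.conjClass δ a →
      SkewPoly.RightDvd (SkewPoly.seqPoly δ b)
        (SkewPoly.minPoly (SkewPoly.points δ (SkewPoly.conjClass δ a)) ^ r)) ∧
    -- item 2, and the statement on P-bases of item 3
    (∀ (m : ℕ) (p : Fin m → F), Function.Injective p →
      SkewPoly.IsPBasis (SkewPoly.linearUniv δ) (SkewPoly.points δ (Set.range p))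
        (SkewPoly.points δ (SkewPoly.conjClass δ a)) →
      ∀ s : Fin m → Fin r → F, (∀ i, SkewPoly.IsMultSeq δ (s i)) → (∀ i, s i ⟨0, hr⟩ = p i) →
        SkewPoly.minPoly (Set.range fun i => SkewPoly.seqPoly δ (s i)) =
            SkewPoly.minPoly (SkewPoly.points δ (SkewPoly.conjClass δ a)) ^ r ∧
          SkewPoly.IsPBasis (SkewPoly.multUniv δ) (Set.range fun i => SkewPoly.seqPoly δ (s i))
            (SkewPoly.multConjClass δ r a)) ∧
    -- the rest of item 3
    SkewPoly.multConjClass δ r a ⊆ SkewPoly.multUniv δ ∧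
    SkewPoly.IsPClosed (SkewPoly.multUniv δ) (SkewPoly.multConjClass δ r a) ∧
    SkewPoly.minPoly (SkewPoly.multConjClass δ r a) =
      SkewPoly.minPoly (SkewPoly.points δ (SkewPoly.conjClass δ a)) ^ r ∧
    SkewPoly.rank (SkewPoly.multConjClass δ r a) =
      (r : WithBot ℕ) * SkewPoly.rank (SkewPoly.points δ (SkewPoly.conjClass δ a)) := by
  have hmon := SkewPoly.isMonic_pow (SkewPoly.isMonic_classPoly (halg a)) r
  have hclass := SkewPoly.minPoly_eq_of_vanishing
    (fun q hq => SkewPoly.multUniv_ne_zero (SkewPoly.multConjClass_subset_multUniv r a hq)) hmon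
    fun _ => SkewPoly.mem_vanishing_multConjClass_iff halg hr
  have hclosed : SkewPoly.IsPClosed (SkewPoly.multUniv δ) (SkewPoly.multConjClass δ r a) :=
    SkewPoly.pClosure_eq_multConjClass halg hr
      fun _ => SkewPoly.mem_vanishing_multConjClass_iff halg hr
  refine ⟨fun b hb hba => SkewPoly.rightDvd_iff_mem_span.mpr (hb.classPoly_pow_mem halg hr hba), ?_,
    SkewPoly.multConjClass_subset_multUniv r a, hclosed, hclass, ?_⟩
  · intro m p hinj hB s hs hs₀
    obtain ⟨hp, hm⟩ := SkewPoly.iInf_eq_of_isPBasis halg hinj hB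
    have hinf := SkewPoly.iInf_span_seqPoly_eq hp (by rw [hm, Fintype.card_fin]) halg hr s hs hs₀
    have hne : ∀ q ∈ Set.range fun i => SkewPoly.seqPoly δ (s i), q ≠ 0 := by
      rintro _ ⟨i, rfl⟩
      exact SkewPoly.seqPoly_ne_zero _
    have hvan : ∀ g, g ∈ SkewPoly.vanishing (Set.range fun i => SkewPoly.seqPoly δ (s i)) ↔
        g ∈ Ideal.span {SkewPoly.classPoly δ a ^ r} := fun g => by
      rw [SkewPoly.mem_vanishing_iff hne, ← hinf, Submodule.mem_iInf, Set.forall_mem_range]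
    have hmin := SkewPoly.minPoly_eq_of_vanishing hne hmon hvan
    have hcl := SkewPoly.pClosure_eq_multConjClass halg hr hvan
    have hU : (Set.range fun i => SkewPoly.seqPoly δ (s i)) ⊆ SkewPoly.multUniv δ := by
      rintro _ ⟨i, rfl⟩
      exact ⟨r, s i, hs i, rfl⟩
    -- The family lies in its own closure C_r(a), so each element serves as its own multiple, with
    -- cofactor 1.
    refine ⟨hmin, hclosed, hU, fun S _ hS => ⟨id, Set.injOn_id _, fun q hq => ⟨?_, 1, ?_⟩⟩,
      ⟨SkewPoly.isAlg_of_mem hmon.ne_zero ((hvan _).mpr (Ideal.mem_span_singleton_self _)), ?_⟩, hcl⟩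
    · rw [← hcl]
      exact ⟨hU (hS hq), fun g hg => hg _ (hS hq)⟩
    · exact (one_mul q).symm
    · classical
      -- P-independence sums degrees over a set, so the P_i must be distinct: the unique zero of P_i
      -- recovers p_i.
      have hsinj : Function.Injective fun i => SkewPoly.seqPoly δ (s i) := fun i j hij => by
        have h : SkewPoly.seqPoly δ (s i) ∈ Ideal.span {SkewPoly.linear δ (s i ⟨0, hr⟩)} :=
          SkewPoly.seqPoly_mem_span_linear_head _ hr
        rw [show SkewPoly.seqPoly δ (s i) = SkewPoly.seqPoly δ (s j) from hij,
          (hs j).seqPoly_mem_iff hr, hs₀, hs₀] at h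
        exact hinj h
      refine ⟨Finset.univ.image fun i => SkewPoly.seqPoly δ (s i), by simp, ?_⟩
      rw [hmin, Finset.sum_image fun i _ j _ hij => hsinj hij, SkewPoly.degree_pow hm r]
      simp [SkewPoly.degree_seqPoly, mul_comm]
  · obtain ⟨m, hm, -⟩ := SkewPoly.isMonic_classPoly (halg a)
    rw [SkewPoly.rank, SkewPoly.rank, hclass, SkewPoly.degree_pow hm r, hm]
    exact Nat.cast_mul r m
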